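/- **Conventions.** Fix $\Bbbk\in\{\mathbb R,\mathbb C\}$. An *sc-chain* $\mathbb E$ is a sequence of Banach spaces $(E_k,\|\cdot\|_k)$, $k\in\mathbb N_0$, with injective compact linear maps $\iota_k:E_{k+1}\to E_k$ of norm $\le 1$ with dense image; $\iota^n_m:E_n\to E_m$ ($m\le n$) denotes their composites, and $E_\infty=\bigcap_k E_k$ (compatible sequences) carries the weakest topology making all inclusions $\iota^\infty_k:E_\infty\to E_k$ continuous. For a strictly increasing sequence $\mathbf k=(k_j)_j$ in $\mathbb N_0$ the *rescaling* $\mathbb E^{\mathbf k}$ is the chain $(E_{k_j})_j$; it has the same $E_\infty$. Direct sums of chains are formed levelwise. An *sc-structure* on a topological vector space $E$ is an sc-chain $\mathbb E$ with an isomorphism of topological vector spaces $E_\infty\cong E$. Two sc-structures $\mathbb E,\tilde{\mathbb E}$ on $E$ are *equivalent* if there are strictly increasing $\mathbf k,\mathbf l$ such that the identity of $E$ extends to injective continuous linear maps $E_{k_j}\to\tilde E_{l_j}$ ($j\in\mathbb N_0$) commuting with the inclusions, and likewise with the roles of $\mathbb E,\tilde{\mathbb E}$ exchanged. An *$\overline{\mathrm{sc}}$-Fréchet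 space* is a topological vector space with an equivalence class of sc-structures, called compatible; products carry the class of the direct sum. An *envelope* of a map $f:A\to E'$, $A\subseteq E$, consists of compatible sc-structures $\mathbb E,\mathbb E'$ on $E,E'$, open sets $U_k\subseteq E_k$ with $\iota_k(U_{k+1})\subseteq U_k$ and $A=\bigcap_k(\iota^\infty_k)^{-1}(U_k)$, and continuous maps $f_k:U_k\to E'_k$ with $f_k\circ\iota^\infty_k=\iota'^\infty_k\circ f$ on $A$ and $f_k\circ\iota_k=\iota'_k\circ f_{k+1}$ on $U_{k+1}$. For $U\subseteq E$ open, $f:U\to E'$ is $\overline{\mathrm{sc}}^0$ if every $x\in U$ has a neighbourhood $V\subseteq U$ such that $f|_V$ has an envelope. A *family of morphisms* over $U$ from $E^1$ to $E^2$ is an $\overline{\mathrm{sc}}^0$ map $\phi:U\times E^1\to E^2$, $(x,u)\mapsto\phi(x)u$, linear in $u$. It is *invertible* if there is a family $\phi^{-1}:U\times E^2\to E^1$ with $\phi^{-1}(x)\phi(x)=\mathrm{id}$ and $\phi(x)\phi^{-1}(x)=\mathrm{id}$ for all $x\in U$. A family $\kappa:U\times E^1\to E^2$ is *strongly smoothing*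 if every $x\in U$ has a neighbourhood $V\subseteq U$ for which there is an envelope $(\kappa_j:U_j\times E^1_j\to E^2_j)_j$ of $\kappa|_{V\times E^1}$ (with respect to compatible sc-structures $\mathbb E$, $\mathbb E^1$, $\mathbb E^2$) such that for every strictly increasing sequence $\mathbf k$ there is an envelope $(\kappa_{\mathbf k,j}:U_{k_j}\times E^1_j\to E^2_{k_j})_j$ of $\kappa|_{V\times E^1}$ (with respect to $\mathbb E^{\mathbf k}\oplus\mathbb E^1$ and $(\mathbb E^2)^{\mathbf k}$) with $\kappa_j(\iota^{k_j}_jx,u)=(\iota^2)^{k_j}_j\kappa_{\mathbf k,j}(x,u)$ for all $j$, $x\in U_{k_j}$, $u\in E^1_j$. A family $\phi:U\times E^1\to E^2$ is *Fredholm* if every $x_0\in U$ has an open neighbourhood $V\subseteq U$ for which there are a family $\psi:V\times E^2\to E^1$ and strongly smoothing families $\kappa:V\times E^1\to E^1$, $\kappa':V\times E^2\to E^2$ with $\psi(x)\phi(x)=\mathrm{id}+\kappa(x)$ and $\phi(x)\psi(x)=\mathrm{id}+\kappa'(x)$ for $x\in V$. Its *index* is the function $(\operatorname{ind}\phi)(x)=\dim\ker\phi(x)-\dim\operatorname{coker}\phi(x)$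 on $U$. In the *tame context* all rescaling sequences, including those in the definition of equivalence of sc-structures, are restricted to those with $k_j\le j+C$ for a constant $C$ (the resulting spaces are the *pre-tame* $\overline{\mathrm{sc}}$-Fréchet spaces); all $\overline{\mathrm{sc}}^0$ maps and families are required to be tame, that is, the local envelopes $(f_k:U_k\to E'_k)_k$ can be chosen so that for every $k$ there is $C_k$ with $\|f_k(x)\|\le C_k(1+\|x\|)$ on $U_k$; and in the definition of strongly smoothing the maps $\kappa_j$ and $\kappa_{\mathbf k,j}$ are required to satisfy such estimates locally along the zero section, namely on the set of $(x,u)$ in their domain with $\|(\iota^1)^j_0u\|_0<1$. **Proposition.** Let $E,E',E^1,E^2,E^3$ be $\overline{\mathrm{sc}}$-Fréchet spaces and let $U\subseteq E$ and $U'\subseteq E'$ be open. (A) Let $x_0\in U$ and let $\phi,\kappa:U\times E^1\to E^2$ be families of morphisms with $\phi$ invertible and $\kappa$ strongly smoothing with $\kappa(x_0)=0$. Then there are an open neighbourhood $V\subseteq U$ of $x_0$ and a strongly smoothing family $\kappa':V\times E^2\to E^1$ with $\kappa'(x_0)=0$ such that $(\phi+\kappa)|_V$ is invertible with inverse $\phi^{-1}|_V+\kappa'$.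 (B) Let $f:U'\to U$ be an $\overline{\mathrm{sc}}^0$ map, let $\phi:U\times E^1\to E^2$ and $\psi:U\times E^2\to E^3$ be Fredholm families and let $\kappa:U\times E^1\to E^2$ be a strongly smoothing family. Then, at every point, all the families below consist of Fredholm operators (continuous, with finite-dimensional kernel and cokernel), and 1. the pullback $f^*\phi:U'\times E^1\to E^2$, $(x',u)\mapsto\phi(f(x'))u$, is Fredholm with $\operatorname{ind}(f^*\phi)=(\operatorname{ind}\phi)\circ f$; 2. $\psi\circ\phi:U\times E^1\to E^3$, $(x,u)\mapsto\psi(x)\phi(x)u$, is Fredholm with $\operatorname{ind}(\psi\circ\phi)=\operatorname{ind}\psi+\operatorname{ind}\phi$; 3. $\phi+\kappa:U\times E^1\to E^2$ is Fredholm with $\operatorname{ind}(\phi+\kappa)=\operatorname{ind}\phi$. Both (A) and (B) also hold in the tame context. -/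

import Mathlib

open Set Topology

universe u u' u₁ u₂ u₃ v

/-! ## sc-chains -/

/-- An sc-chain over `𝕜`: Banach spaces `X 0, X 1, …` with injective compact linear maps
`ι k : X (k+1) → X k` of norm at most one and with dense image. -/
structure ScChain (𝕜 : Type v) [RCLike 𝕜] where
  X : ℕ → Type u
  [normed : ∀ k, NormedAddCommGroup (X k)]
  [space : ∀ k, NormedSpace 𝕜 (X k)]
  [complete : ∀ k, CompleteSpace (X k)]
  ι : ∀ k, X (k + 1) →L[𝕜] X k
  ι_injective : ∀ k, Function.Injective (ι k)
  ι_denseRange : ∀ k, DenseRange (ι k)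
  ι_norm_le : ∀ k, ‖ι k‖ ≤ 1
  ι_compact : ∀ k, IsCompactOperator (ι k)

attribute [instance] ScChain.normed ScChain.space ScChain.complete

namespace ScChain

variable {𝕜 : Type v} [RCLike 𝕜]

/-- The inclusion `X n → X m` for `m ≤ n`, the composite of the maps `ι`. -/
noncomputable def incl (C : ScChain.{u} 𝕜) {m n : ℕ} (h : m ≤ n) : C.X n →L[𝕜] C.X m :=
  Nat.leRec (motive := fun n _ => C.X n →L[𝕜] C.X m)
    (ContinuousLinearMap.id 𝕜 (C.X m)) (fun n _ T => T.comp (C.ι n)) h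

theorem incl_self (C : ScChain.{u} 𝕜) (m : ℕ) :
    C.incl (le_refl m) = ContinuousLinearMap.id 𝕜 (C.X m) := by
  unfold incl
  exact Nat.leRec_self _ _

theorem incl_succ (C : ScChain.{u} 𝕜) {m n : ℕ} (h : m ≤ n) :
    C.incl (Nat.le_succ_of_le h) = (C.incl h).comp (C.ι n) := by
  unfold incl
  exact Nat.leRec_succ _ _ h

theorem incl_comp (C : ScChain.{u} 𝕜) {l m n : ℕ} (h₁ : l ≤ m) (h₂ : m ≤ n) :
    (C.incl h₁).comp (C.incl h₂) = C.incl (h₁.trans h₂) := by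
  induction n, h₂ using Nat.le_induction with
  | base => rw [incl_self]; rfl
  | succ n hn ih =>
    rw [incl_succ C hn, incl_succ C (h₁.trans hn), ← ih]; rfl

theorem incl_one (C : ScChain.{u} 𝕜) (n : ℕ) : C.incl (Nat.le_succ n) = C.ι n := by
  have h := incl_succ C (le_refl n)
  rw [incl_self] at h
  exact h

theorem incl_injective (C : ScChain.{u} 𝕜) {m n : ℕ} (h : m ≤ n) :
    Function.Injective (C.incl h) := by
  induction n, h using Nat.le_induction with
  | base => rw [incl_self]; exact Function.injective_id
  | succ n hn ih =>
    rw [incl_succ C hn]; exact ih.comp (C.ι_injective n)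

theorem incl_denseRange (C : ScChain.{u} 𝕜) {m n : ℕ} (h : m ≤ n) :
    DenseRange (C.incl h) := by
  induction n, h using Nat.le_induction with
  | base => rw [incl_self]; exact Function.surjective_id.denseRange
  | succ n hn ih =>
    rw [incl_succ C hn]
    exact ih.comp (C.ι_denseRange n) (C.incl hn).continuous

theorem incl_norm_le (C : ScChain.{u} 𝕜) {m n : ℕ} (h : m ≤ n) : ‖C.incl h‖ ≤ 1 := by
  induction n, h using Nat.le_induction with
  | base => rw [incl_self]; exact ContinuousLinearMap.norm_id_le
  | succ n hn ih =>
    rw [incl_succ C hn]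
    calc _ ≤ ‖C.incl hn‖ * ‖C.ι n‖ := ContinuousLinearMap.opNorm_comp_le _ _
      _ ≤ 1 * 1 := by gcongr; exact C.ι_norm_le n
      _ = 1 := one_mul 1

theorem incl_compact (C : ScChain.{u} 𝕜) {m n : ℕ} (h : m < n) :
    IsCompactOperator (C.incl h.le) := by
  have h' : m + 1 ≤ n := h
  rw [← incl_comp C (Nat.le_succ m) h', incl_one]
  exact (C.ι_compact m).comp_clm _

/-- The space `E_∞`: compatible sequences (the intersection of all the `X k`), with the weakest
topology for which all projections to the `X k` are continuous. -/
def lim (C : ScChain.{u} 𝕜) : Submodule 𝕜 (∀ k, C.X k) where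
  carrier := {x | ∀ k, C.ι k (x (k + 1)) = x k}
  zero_mem' := fun k => by simp
  add_mem' := fun {x y} hx hy k => by simp [hx k, hy k]
  smul_mem' := fun a x hx k => by simp [hx k]

theorem incl_of_mem_lim (C : ScChain.{u} 𝕜) {x : ∀ k, C.X k} (hx : x ∈ C.lim) {m n : ℕ}
    (h : m ≤ n) : C.incl h (x n) = x m := by
  induction n, h using Nat.le_induction with
  | base => rw [incl_self]; rfl
  | succ n hn ih =>
    rw [incl_succ C hn, ContinuousLinearMap.comp_apply, hx n, ih]

/-- The rescaling of a chain by a strictly increasing sequence `k`. -/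
noncomputable abbrev rescale (C : ScChain.{u} 𝕜) (k : ℕ → ℕ) (hk : StrictMono k) :
    ScChain.{u} 𝕜 where
  X := fun j => C.X (k j)
  ι := fun j => C.incl (hk.monotone (Nat.le_succ j))
  ι_injective := fun _ => C.incl_injective _
  ι_denseRange := fun _ => C.incl_denseRange _
  ι_norm_le := fun _ => C.incl_norm_le _
  ι_compact := fun j => C.incl_compact (hk (Nat.lt_succ_self j))

theorem incl_of_mem_lim_rescale (C : ScChain.{u} 𝕜) (k : ℕ → ℕ) (hk : StrictMono k)
    {y : ∀ j, C.X (k j)} (hy : y ∈ (C.rescale k hk).lim) {i j : ℕ} (h : i ≤ j) :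
    C.incl (hk.monotone h) (y j) = y i := by
  induction j, h using Nat.le_induction with
  | base => rw [incl_self]; rfl
  | succ n hn ih =>
    have h1 : C.incl (hk.monotone (Nat.le_succ n)) (y (n + 1)) = y n := hy n
    rw [← ih, ← h1, ← ContinuousLinearMap.comp_apply, incl_comp]

theorem ι_incl_of_mem_lim_rescale (C : ScChain.{u} 𝕜) (k : ℕ → ℕ) (hk : StrictMono k)
    {y : ∀ j, C.X (k j)} (hy : y ∈ (C.rescale k hk).lim) (m : ℕ) :
    C.ι m (C.incl (hk.le_apply (x := m + 1)) (y (m + 1))) =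
      C.incl (hk.le_apply (x := m)) (y m) := by
  have h1 := incl_of_mem_lim_rescale C k hk hy (Nat.le_succ m)
  rw [← incl_one, ← h1, ← ContinuousLinearMap.comp_apply, ← ContinuousLinearMap.comp_apply,
    incl_comp, incl_comp]

/-- A rescaling has the same `E_∞`. -/
noncomputable def rescaleLim (C : ScChain.{u} 𝕜) (k : ℕ → ℕ) (hk : StrictMono k) :
    (C.rescale k hk).lim ≃L[𝕜] C.lim where
  toFun := fun y => ⟨fun m => C.incl (hk.le_apply (x := m)) (y.1 m),
    fun m => ι_incl_of_mem_lim_rescale C k hk y.2 m⟩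
  invFun := fun x => ⟨fun j => x.1 (k j), fun j => incl_of_mem_lim C x.2 _⟩
  left_inv := fun y => by
    apply Subtype.ext
    funext j
    exact incl_of_mem_lim_rescale C k hk y.2 (hk.le_apply (x := j))
  right_inv := fun x => by
    apply Subtype.ext
    funext j
    exact incl_of_mem_lim C x.2 _
  map_add' := fun x y => by
    apply Subtype.ext
    funext m
    exact map_add (C.incl (hk.le_apply (x := m))) (x.1 m) (y.1 m)
  map_smul' := fun a x => by
    apply Subtype.ext
    funext m
    exact map_smul (C.incl (hk.le_apply (x := m))) a (x.1 m)
  continuous_toFun := by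
    refine Continuous.subtype_mk (continuous_pi fun m => ?_) _
    exact (C.incl _).continuous.comp ((continuous_apply m).comp continuous_subtype_val)
  continuous_invFun := by
    refine Continuous.subtype_mk (continuous_pi fun j => ?_) _
    exact (continuous_apply (k j)).comp continuous_subtype_val

/-- The direct sum of two chains. The levels carry the maximum norm, which is equivalent, with
constants independent of the level, to the sum of the two norms. -/
noncomputable abbrev prod (C : ScChain.{u} 𝕜) (D : ScChain.{u'} 𝕜) : ScChain.{max u u'} 𝕜 where
  X := fun k => C.X k × D.X k
  ι := fun k => (C.ι k).prodMap (D.ι k)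
  ι_injective := fun k => (C.ι_injective k).prodMap (D.ι_injective k)
  ι_denseRange := fun k => (C.ι_denseRange k).prodMap (D.ι_denseRange k)
  ι_norm_le := fun k => by
    refine ContinuousLinearMap.opNorm_le_bound _ zero_le_one fun x => ?_
    rw [one_mul]
    refine max_le ?_ ?_
    · exact ((C.ι k).le_of_opNorm_le (C.ι_norm_le k) x.1).trans
        (by rw [one_mul]; exact norm_fst_le x)
    · exact ((D.ι k).le_of_opNorm_le (D.ι_norm_le k) x.2).trans
        (by rw [one_mul]; exact norm_snd_le x)
  ι_compact := fun k => by
    obtain ⟨K, hK, hKn⟩ := C.ι_compact k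
    obtain ⟨L, hL, hLn⟩ := D.ι_compact k
    exact ⟨K ×ˢ L, hK.prod hL, prod_mem_nhds hKn hLn⟩

/-- `(E ⊕ F)_∞ = E_∞ × F_∞`. -/
noncomputable def prodLim (C : ScChain.{u} 𝕜) (D : ScChain.{u'} 𝕜) :
    (C.prod D).lim ≃L[𝕜] (C.lim × D.lim) where
  toFun := fun z => (⟨fun k => (z.1 k).1, fun k => congrArg Prod.fst (z.2 k)⟩,
    ⟨fun k => (z.1 k).2, fun k => congrArg Prod.snd (z.2 k)⟩)
  invFun := fun p => ⟨fun k => (p.1.1 k, p.2.1 k), fun k => Prod.ext (p.1.2 k) (p.2.2 k)⟩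
  left_inv := fun _ => rfl
  right_inv := fun _ => rfl
  map_add' := fun _ _ => rfl
  map_smul' := fun _ _ => rfl
  continuous_toFun := by
    refine Continuous.prodMk ?_ ?_
    · refine Continuous.subtype_mk (continuous_pi fun k => ?_) _
      exact continuous_fst.comp ((continuous_apply k).comp continuous_subtype_val)
    · refine Continuous.subtype_mk (continuous_pi fun k => ?_) _
      exact continuous_snd.comp ((continuous_apply k).comp continuous_subtype_val)
  continuous_invFun := by
    refine Continuous.subtype_mk (continuous_pi fun k => ?_) _
    exact Continuous.prodMk
      ((continuous_apply k).comp (continuous_subtype_val.comp continuous_fst))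
      ((continuous_apply k).comp (continuous_subtype_val.comp continuous_snd))

end ScChain

/-- A continuous linear operator between chains: one at each level, commuting with the
inclusions. -/
structure ScChain.Hom {𝕜 : Type v} [RCLike 𝕜] (C : ScChain.{u} 𝕜) (D : ScChain.{u'} 𝕜) where
  map : ∀ k, C.X k →L[𝕜] D.X k
  comm : ∀ k x, map k (C.ι k x) = D.ι k (map (k + 1) x)

/-! ## sc-structures and sc-Fréchet spaces -/

/-- The two contexts in which the theory is developed in parallel: the plain one and the tame
one. -/
inductive ScContext : Type
  | plain
  | tame

/-- The rescaling sequences allowed in a context: strictly increasing ones, which in the tame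
context have to satisfy `k j ≤ j + C` for some constant `C`. -/
def ScContext.Admissible (c : ScContext) (k : ℕ → ℕ) : Prop :=
  StrictMono k ∧ (c = ScContext.tame → ∃ C : ℕ, ∀ j, k j ≤ j + C)

/-- An sc-structure on the topological vector space `E`: an sc-chain with an isomorphism of
topological vector spaces from its `E_∞` to `E`. -/
structure ScStructure (𝕜 : Type v) [RCLike 𝕜] (E : Type u) [AddCommGroup E] [Module 𝕜 E]
    [TopologicalSpace E] where
  chain : ScChain.{u} 𝕜
  equiv : chain.lim ≃L[𝕜] E

namespace ScStructure

section

variable {𝕜 : Type v} [RCLike 𝕜]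
variable {E : Type u} [AddCommGroup E] [Module 𝕜 E] [TopologicalSpace E]
variable {F : Type u'} [AddCommGroup F] [Module 𝕜 F] [TopologicalSpace F]

/-- The inclusion of `E` into level `k` of the chain. -/
noncomputable def coord (S : ScStructure 𝕜 E) (k : ℕ) : E →L[𝕜] S.chain.X k :=
  (ContinuousLinearMap.proj k).comp
    (S.chain.lim.subtypeL.comp (S.equiv.symm : E →L[𝕜] S.chain.lim))

/-- The sc-structure given by a rescaled chain. -/
noncomputable abbrev rescale (S : ScStructure 𝕜 E) (k : ℕ → ℕ) (hk : StrictMono k) :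
    ScStructure 𝕜 E where
  chain := S.chain.rescale k hk
  equiv := (S.chain.rescaleLim k hk).trans S.equiv

/-- The direct sum of two sc-structures. -/
noncomputable abbrev prod (S : ScStructure 𝕜 E) (T : ScStructure 𝕜 F) : ScStructure 𝕜 (E × F) where
  chain := S.chain.prod T.chain
  equiv := (S.chain.prodLim T.chain).trans (S.equiv.prodCongr T.equiv)

theorem coord_rescale (S : ScStructure 𝕜 E) (k : ℕ → ℕ) (hk : StrictMono k) (j : ℕ) (x : E) :
    (S.rescale k hk).coord j x = S.coord (k j) x := rfl

theorem coord_prod (S : ScStructure 𝕜 E) (T : ScStructure 𝕜 F) (j : ℕ) (p : E × F) :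
    (S.prod T).coord j p = (S.coord j p.1, T.coord j p.2) := rfl

/-- The identity of `E`, read from the chain of `S` to that of `T`, is a weak embedding: between
suitable (admissible) rescalings it extends to a levelwise injective continuous linear operator
of chains. -/
def WeaklyEmbeds (c : ScContext) (S T : ScStructure 𝕜 E) : Prop :=
  ∃ (k l : ℕ → ℕ) (hk : c.Admissible k) (hl : c.Admissible l)
    (J : ScChain.Hom (S.chain.rescale k hk.1) (T.chain.rescale l hl.1)),
    (∀ j, Function.Injective (J.map j)) ∧
      ∀ (j : ℕ) (x : E), J.map j (S.coord (k j) x) = T.coord (l j) x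

/-- (Tame) equivalence of sc-structures on `E`. -/
def Equivalent (c : ScContext) (S T : ScStructure 𝕜 E) : Prop :=
  WeaklyEmbeds c S T ∧ WeaklyEmbeds c T S

end

end ScStructure

/-- An sc-Fréchet space, respectively a pre-tame sc-Fréchet space: a topological vector space with
a (tame) equivalence class of sc-structures. The class is presented by a representative `base`;
this representative is used only through its class `ScFrechetSpace.Compatible`. -/
class ScFrechetSpace (𝕜 : Type v) [RCLike 𝕜] (E : Type u) [AddCommGroup E] [Module 𝕜 E]
    [TopologicalSpace E] where
  base : ScStructure 𝕜 E

/-- The (tamely) compatible sc-structures of an sc-Fréchet space. -/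
def ScFrechetSpace.Compatible {𝕜 : Type v} [RCLike 𝕜] {E : Type u} [AddCommGroup E] [Module 𝕜 E]
    [TopologicalSpace E] [ScFrechetSpace 𝕜 E] (c : ScContext) (S : ScStructure 𝕜 E) : Prop :=
  ScStructure.Equivalent c (ScFrechetSpace.base (𝕜 := 𝕜) (E := E)) S

/-- The direct sum of two sc-Fréchet spaces. -/
noncomputable instance ScFrechetSpace.instProd {𝕜 : Type v} [RCLike 𝕜]
    {E : Type u} [AddCommGroup E] [Module 𝕜 E] [TopologicalSpace E] [ScFrechetSpace 𝕜 E]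
    {F : Type u'} [AddCommGroup F] [Module 𝕜 F] [TopologicalSpace F] [ScFrechetSpace 𝕜 F] :
    ScFrechetSpace 𝕜 (E × F) where
  base := (ScFrechetSpace.base (𝕜 := 𝕜) (E := E)).prod (ScFrechetSpace.base (𝕜 := 𝕜) (E := F))

/-! ## Envelopes, sc-continuous maps and families of morphisms -/

/-- `f` satisfies a tame estimate on `A`. -/
def TameEstimateOn {X : Type u} {Y : Type u'} [Norm X] [Norm Y] (f : X → Y) (A : Set X) : Prop :=
  ∃ C : ℝ, ∀ x ∈ A, ‖f x‖ ≤ C * (1 + ‖x‖)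

section Families

variable {𝕜 : Type v} [RCLike 𝕜]
variable {E : Type u} [AddCommGroup E] [Module 𝕜 E] [TopologicalSpace E]
variable {E' : Type u'} [AddCommGroup E'] [Module 𝕜 E'] [TopologicalSpace E']
variable {E₁ : Type u₁} [AddCommGroup E₁] [Module 𝕜 E₁] [TopologicalSpace E₁]
variable {E₂ : Type u₂} [AddCommGroup E₂] [Module 𝕜 E₂] [TopologicalSpace E₂]

/-- `F k : U k → X' k` is an envelope of `f : A → E'` with respect to the sc-structures `S` and
`S'`. The values of `f` off `A` and of `F k` off `U k` play no role. -/
structure IsEnvelope (S : ScStructure 𝕜 E) (S' : ScStructure 𝕜 E') (A : Set E) (f : E → E')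
    (U : ∀ k, Set (S.chain.X k)) (F : ∀ k, S.chain.X k → S'.chain.X k) : Prop where
  isOpen : ∀ k, IsOpen (U k)
  mapsTo : ∀ k, MapsTo (S.chain.ι k) (U (k + 1)) (U k)
  eq_iInter : A = ⋂ k, S.coord k ⁻¹' U k
  continuousOn : ∀ k, ContinuousOn (F k) (U k)
  extend : ∀ k, ∀ a ∈ A, F k (S.coord k a) = S'.coord k (f a)
  comm : ∀ k, ∀ x ∈ U (k + 1), F k (S.chain.ι k x) = S'.chain.ι k (F (k + 1) x)

variable (𝕜)

/-- `f : U → E'` is an sc⁰ map, in the tame context a tame one: every point of `U` has a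
neighbourhood on which `f` has an envelope, in the tame context one whose maps all satisfy tame
estimates. -/
def IsScContinuousOn [ScFrechetSpace 𝕜 E] [ScFrechetSpace 𝕜 E'] (c : ScContext) (U : Set E)
    (f : E → E') : Prop :=
  ∀ x ∈ U, ∃ V ∈ 𝓝 x, V ⊆ U ∧
    ∃ (S : ScStructure 𝕜 E) (S' : ScStructure 𝕜 E')
      (W : ∀ k, Set (S.chain.X k)) (F : ∀ k, S.chain.X k → S'.chain.X k),
      ScFrechetSpace.Compatible c S ∧ ScFrechetSpace.Compatible c S' ∧
      IsEnvelope S S' V f W F ∧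
      (c = ScContext.tame → ∀ k, TameEstimateOn (F k) (W k))

variable {𝕜}
variable [ScFrechetSpace 𝕜 E] [ScFrechetSpace 𝕜 E₁] [ScFrechetSpace 𝕜 E₂]

/-- `φ` is an sc⁰ family (in the tame context: a tame sc⁰ family) of morphisms from `E₁` to `E₂`
over `U`: the map `(x, u) ↦ φ x u` on `U × E₁`, which is linear in `u`, is sc⁰. The values of `φ`
off `U` play no role. -/
def IsFamily (c : ScContext) (U : Set E) (φ : E → E₁ →ₗ[𝕜] E₂) : Prop :=
  IsScContinuousOn 𝕜 c (U ×ˢ (univ : Set E₁)) (fun p : E × E₁ => φ p.1 p.2)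

/-- `φ` and `ψ` are families of morphisms over `U` that are inverse to each other. -/
def IsInverseFamily (c : ScContext) (U : Set E) (φ : E → E₁ →ₗ[𝕜] E₂) (ψ : E → E₂ →ₗ[𝕜] E₁) :
    Prop :=
  IsFamily c U φ ∧ IsFamily c U ψ ∧
    ∀ x ∈ U, (ψ x).comp (φ x) = LinearMap.id ∧ (φ x).comp (ψ x) = LinearMap.id

/-- The family `κ` has a strongly smoothing envelope over `V`: an envelope `K` defined on
`W j × X₁ j` that, for every (admissible) rescaling sequence `k`, lifts to an envelope defined on
`W (k j) × X₁ j` with values in level `k j`. In the tame context the maps satisfy tame estimates,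
locally along the zero section: over `W` times the neighbourhood of zero in `E₁` given by the
open unit balls of the level zero norm. (On all of `W j × X₁ j` a tame estimate for a map that is
linear in the second variable would be a bound independent of the first variable.) -/
def HasStronglySmoothingEnvelope (c : ScContext) (V : Set E) (κ : E → E₁ →ₗ[𝕜] E₂) : Prop :=
  ∃ (S : ScStructure 𝕜 E) (S₁ : ScStructure 𝕜 E₁) (S₂ : ScStructure 𝕜 E₂)
    (W : ∀ j, Set (S.chain.X j)) (K : ∀ j, S.chain.X j × S₁.chain.X j → S₂.chain.X j),
    ScFrechetSpace.Compatible c S ∧ ScFrechetSpace.Compatible c S₁ ∧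
    ScFrechetSpace.Compatible c S₂ ∧
    IsEnvelope (S.prod S₁) S₂ (V ×ˢ (univ : Set E₁)) (fun p : E × E₁ => κ p.1 p.2)
      (fun j => W j ×ˢ (univ : Set (S₁.chain.X j))) K ∧
    (c = ScContext.tame → ∀ j, TameEstimateOn (K j)
      (W j ×ˢ {u : S₁.chain.X j | ‖S₁.chain.incl (Nat.zero_le j) u‖ < 1})) ∧
    ∀ (k : ℕ → ℕ) (hk : c.Admissible k),
      ∃ K' : ∀ j, S.chain.X (k j) × S₁.chain.X j → S₂.chain.X (k j),
        IsEnvelope ((S.rescale k hk.1).prod S₁) (S₂.rescale k hk.1) (V ×ˢ (univ : Set E₁))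
          (fun p : E × E₁ => κ p.1 p.2)
          (fun j => W (k j) ×ˢ (univ : Set (S₁.chain.X j))) K' ∧
        (c = ScContext.tame → ∀ j, TameEstimateOn (K' j)
          (W (k j) ×ˢ {u : S₁.chain.X j | ‖S₁.chain.incl (Nat.zero_le j) u‖ < 1})) ∧
        ∀ j, ∀ x ∈ W (k j), ∀ u : S₁.chain.X j,
          K j (S.chain.incl (hk.1.le_apply (x := j)) x, u) =
            S₂.chain.incl (hk.1.le_apply (x := j)) (K' j (x, u))

/-- `κ` is a strongly smoothing family of morphisms over `U`. -/
def IsStronglySmoothing (c : ScContext) (U : Set E) (κ : E → E₁ →ₗ[𝕜] E₂) : Prop :=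
  IsFamily c U κ ∧ ∀ x ∈ U, ∃ V ∈ 𝓝 x, V ⊆ U ∧ HasStronglySmoothingEnvelope c V κ

/-- `φ` is a Fredholm family over `U`: locally it is invertible modulo strongly smoothing
families. -/
def IsFredholmFamily (c : ScContext) (U : Set E) (φ : E → E₁ →ₗ[𝕜] E₂) : Prop :=
  IsFamily c U φ ∧ ∀ x₀ ∈ U, ∃ V : Set E, IsOpen V ∧ x₀ ∈ V ∧ V ⊆ U ∧
    ∃ (ψ : E → E₂ →ₗ[𝕜] E₁) (κ : E → E₁ →ₗ[𝕜] E₁) (κ' : E → E₂ →ₗ[𝕜] E₂),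
      IsFamily c V ψ ∧ IsStronglySmoothing c V κ ∧ IsStronglySmoothing c V κ' ∧
      ∀ x ∈ V, (ψ x).comp (φ x) = LinearMap.id + κ x ∧ (φ x).comp (ψ x) = LinearMap.id + κ' x

end Families

/-! ## Fredholm operators and their index -/

section Fredholm

variable {𝕜 : Type v} [RCLike 𝕜]
variable {E₁ : Type u₁} [AddCommGroup E₁] [Module 𝕜 E₁]
variable {E₂ : Type u₂} [AddCommGroup E₂] [Module 𝕜 E₂]

/-- Fredholm operators between Fréchet spaces. -/
def IsFredholmOperator [TopologicalSpace E₁] [TopologicalSpace E₂] (T : E₁ →ₗ[𝕜] E₂) : Prop :=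
  Continuous T ∧ FiniteDimensional 𝕜 (LinearMap.ker T) ∧
    FiniteDimensional 𝕜 (E₂ ⧸ LinearMap.range T)

/-- The index `dim ker T - dim coker T`. -/
noncomputable def fredholmIndex (T : E₁ →ₗ[𝕜] E₂) : ℤ :=
  (Module.finrank 𝕜 (LinearMap.ker T) : ℤ) - (Module.finrank 𝕜 (E₂ ⧸ LinearMap.range T) : ℤ)

end Fredholm

/-! The definitions allow different compatible sc-structures for every local envelope. The proof
first moves everything to the fixed representatives `baseStructure`. There an sc⁰ family near a
point amounts to norm continuous families of bounded operators `Φ k` into level `k` from some level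
`m k`, with parameters in an open subset of a level (`IsLocalFamily`). For a strongly smoothing
family one source level `n` serves all targets `k` (`IsLocalSmoothing`). The tame context adds
estimates with a fixed loss `r` of levels. Definitions yield local data by `IsFamily.isLocalFamily`
and `HasStronglySmoothingEnvelope.isLocalSmoothing`; the converses are `isFamily_of_isLocalFamily`
and `isStronglySmoothing_of_isLocalSmoothing`. Norm continuity comes from compactness of the
inclusions, at the cost of one level; extensions to levels are compared on the dense subspace `E`.

In local form, sums, composites and pullbacks are bookkeeping of levels, and strongly smoothing
families form an ideal.

For (A), `φ + κ = φ (id + φ⁻¹ κ)` reduces to perturbations of the identity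
(`IsLocalSmoothing.exists_inverse`). Since `κ` reaches every level from one level `N`, it suffices
to invert `id + κ` in the Banach algebra of operators on level `N`; the correction `-κ (id + κ)⁻¹`
is smoothing again. One neighbourhood therefore works for all levels.

For (B), parametrices pull back and compose, and survive smoothing perturbations. At a point, `id +
κ` is a compact perturbation of the identity on level `n`, with the same kernel and cokernel as on
`E_∞`, so Riesz theory gives index zero. Hence an operator with parametrix `θ` is Fredholm of index
`-ind θ`. As `φ` and `φ + κ` share a parametrix, their indices agree without any homotopy argument;
additivity of the index is linear algebra. -/

namespace ScChain

/-! ### Chains: inclusions and density of `E_∞` in every level. -/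

variable {𝕜 : Type v} [RCLike 𝕜]

theorem rescale_incl (C : ScChain.{u} 𝕜) (k : ℕ → ℕ) (hk : StrictMono k) {m n : ℕ} (h : m ≤ n) :
    (C.rescale k hk).incl h = C.incl (hk.monotone h) := by
  induction n, h using Nat.le_induction with
  | base => rw [incl_self, incl_self]
  | succ n hn ih =>
    rw [incl_succ _ hn, ih]
    exact C.incl_comp (hk.monotone hn) (hk.monotone (Nat.le_succ n))

theorem prod_incl (C : ScChain.{u} 𝕜) (D : ScChain.{u'} 𝕜) {m n : ℕ} (h : m ≤ n) :
    (C.prod D).incl h = (C.incl h).prodMap (D.incl h) := by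
  induction n, h using Nat.le_induction with
  | base => rw [incl_self, incl_self, incl_self]; rfl
  | succ n hn ih =>
    rw [incl_succ _ hn, ih, incl_succ _ hn, incl_succ _ hn]; rfl

theorem incl_incl (C : ScChain.{u} 𝕜) {l m n : ℕ} (h₁ : l ≤ m) (h₂ : m ≤ n) (x : C.X n) :
    C.incl h₁ (C.incl h₂ x) = C.incl (h₁.trans h₂) x := by
  rw [← C.incl_comp h₁ h₂]; rfl

theorem norm_incl_apply_le (C : ScChain.{u} 𝕜) {m n : ℕ} (h : m ≤ n) (x : C.X n) :
    ‖C.incl h x‖ ≤ ‖x‖ := by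
  simpa using (C.incl h).le_of_opNorm_le (C.incl_norm_le h) x

/-- Compatible sequences are dense at every level. -/
theorem exists_mem_lim_norm_sub_le (C : ScChain.{u} 𝕜) (k : ℕ) (y : C.X k) {ε : ℝ} (hε : 0 < ε) :
    ∃ x ∈ C.lim, ‖x k - y‖ ≤ ε := by
  -- A Mittag-Leffler argument: climb one level at a time with geometrically small errors. Since
  -- inclusions have norm at most one, these errors stay small when pushed down to any fixed level.
  have step : ∀ (i : ℕ) (a : C.X (k + i)),
      ∃ b : C.X (k + (i + 1)), dist a (C.ι (k + i) b) ≤ ε / 2 / 2 ^ i := fun i a => by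
    obtain ⟨b, hb⟩ := (C.ι_denseRange (k + i)).exists_dist_lt a
      (show 0 < ε / 2 / 2 ^ i by positivity)
    exact ⟨b, hb.le⟩
  choose next hnext using step
  let z : ∀ i, C.X (k + i) := fun i => Nat.rec (motive := fun i => C.X (k + i)) y next i
  have hz : ∀ i, dist (z i) (C.ι (k + i) (z (i + 1))) ≤ ε / 2 / 2 ^ i := fun i => hnext i (z i)
  -- The `i`-th approximation seen at level `j`. The value zero occurs only for the finitely many
  -- `i` that have not yet climbed to level `j`.
  let w : ∀ j, ℕ → C.X j := fun j i => if h : j ≤ k + i then C.incl h (z i) else 0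
  have hw : ∀ j i, (h : j ≤ k + i) → w j i = C.incl h (z i) := fun j i h => dif_pos h
  have hdist : ∀ j i, j ≤ k + i → dist (w j i) (w j (i + 1)) ≤ ε / 2 / 2 ^ i := fun j i h => by
    rw [hw j i h, hw j (i + 1) (by omega)]
    have h1 : C.incl (show j ≤ k + (i + 1) by omega) (z (i + 1)) =
        C.incl h (C.ι (k + i) (z (i + 1))) := by
      rw [← C.incl_one, C.incl_incl]
    rw [h1, dist_eq_norm, ← map_sub]
    refine (C.norm_incl_apply_le h _).trans ?_
    rw [← dist_eq_norm]
    exact hz i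
  have hcauchy : ∀ j, CauchySeq (w j) := fun j => by
    rw [← cauchySeq_shift j]
    refine cauchySeq_of_le_geometric_two (C := ε) fun n => ?_
    refine (le_of_eq_of_le ?_ (hdist j (n + j) (by omega))).trans ?_
    · congr 2; omega
    · gcongr <;> norm_num
  choose x hx using fun j => cauchySeq_tendsto_of_complete (hcauchy j)
  refine ⟨x, fun j => ?_, ?_⟩
  · refine tendsto_nhds_unique (((C.ι j).continuous.tendsto _).comp (hx (j + 1))) ?_
    refine (hx j).congr' ?_
    filter_upwards [Filter.eventually_ge_atTop (j + 1)] with i hi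
    rw [Function.comp_apply, hw j i (by omega), hw (j + 1) i (by omega), ← C.incl_one, C.incl_incl]
  · have h0 : w k 0 = y := by
      rw [hw k 0 (le_refl _)]
      exact congrArg (fun T => T y) (C.incl_self k)
    have := dist_le_of_le_geometric_two_of_tendsto₀ (C := ε) (fun n => hdist k n (by omega)) (hx k)
    rwa [h0, dist_comm, dist_eq_norm] at this

end ScChain

theorem ScContext.Admissible.comp {c : ScContext} {k l : ℕ → ℕ} (hk : c.Admissible k)
    (hl : c.Admissible l) : c.Admissible (fun j => k (l j)) := by
  refine ⟨hk.1.comp hl.1, fun hc => ?_⟩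
  obtain ⟨A, hA⟩ := hk.2 hc
  obtain ⟨B, hB⟩ := hl.2 hc
  exact ⟨A + B, fun j => by have := hA (l j); have := hB j; dsimp only; omega⟩

theorem ScContext.admissible_add (c : ScContext) (q : ℕ) : c.Admissible (fun j => j + q) :=
  ⟨fun _ _ h => Nat.add_lt_add_right h q, fun _ => ⟨q, fun _ => le_refl _⟩⟩

theorem ScContext.admissible_id (c : ScContext) : c.Admissible (fun j => j) :=
  c.admissible_add 0

theorem ScContext.Admissible.add {c : ScContext} {k : ℕ → ℕ} (hk : c.Admissible k) (q : ℕ) :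
    c.Admissible (fun j => k j + q) :=
  (c.admissible_add q).comp hk

theorem ScContext.Admissible.max {c : ScContext} {k l : ℕ → ℕ} (hk : c.Admissible k)
    (hl : c.Admissible l) : c.Admissible (fun j => max (k j) (l j)) := by
  refine ⟨fun i j h => max_lt_max (hk.1 h) (hl.1 h), fun hc => ?_⟩
  obtain ⟨A, hA⟩ := hk.2 hc
  obtain ⟨B, hB⟩ := hl.2 hc
  exact ⟨A + B, fun j => by have := hA j; have := hB j; dsimp only; omega⟩

/-! ### Topology of an sc-structure and changes of structure. -/

namespace ScStructure

variable {𝕜 : Type v} [RCLike 𝕜]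
variable {E : Type u} [AddCommGroup E] [Module 𝕜 E] [TopologicalSpace E]
variable {F : Type u'} [AddCommGroup F] [Module 𝕜 F] [TopologicalSpace F]

theorem incl_coord (S : ScStructure 𝕜 E) {m n : ℕ} (h : m ≤ n) (x : E) :
    S.chain.incl h (S.coord n x) = S.coord m x :=
  S.chain.incl_of_mem_lim (S.equiv.symm x).2 h

theorem ι_coord (S : ScStructure 𝕜 E) (n : ℕ) (x : E) :
    S.chain.ι n (S.coord (n + 1) x) = S.coord n x :=
  (S.equiv.symm x).2 n

theorem norm_coord_mono (S : ScStructure 𝕜 E) {m n : ℕ} (h : m ≤ n) (x : E) :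
    ‖S.coord m x‖ ≤ ‖S.coord n x‖ := by
  rw [← S.incl_coord h]; exact S.chain.norm_incl_apply_le h _

theorem exists_coord_eq (S : ScStructure 𝕜 E) {y : ∀ k, S.chain.X k}
    (hy : ∀ k, S.chain.ι k (y (k + 1)) = y k) : ∃ x : E, ∀ k, S.coord k x = y k :=
  ⟨S.equiv ⟨y, hy⟩, fun k =>
    congrArg (fun z : S.chain.lim => z.1 k) (S.equiv.symm_apply_apply ⟨y, hy⟩)⟩

theorem ext_coord (S : ScStructure 𝕜 E) {x y : E} (h : ∀ k, S.coord k x = S.coord k y) :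
    x = y :=
  S.equiv.symm.injective (Subtype.ext (funext h))

theorem coord_injective (S : ScStructure 𝕜 E) (k : ℕ) : Function.Injective (S.coord k) := by
  intro x y h
  refine S.ext_coord fun j => ?_
  rcases le_total j k with hj | hj
  · rw [← S.incl_coord hj, h, S.incl_coord hj]
  · apply S.chain.incl_injective hj
    rw [S.incl_coord, S.incl_coord, h]

theorem denseRange_coord (S : ScStructure 𝕜 E) (k : ℕ) : DenseRange (S.coord k) := by
  refine Metric.dense_iff.2 fun y r hr => ?_
  obtain ⟨x, hx, hxy⟩ := S.chain.exists_mem_lim_norm_sub_le k y (half_pos hr)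
  obtain ⟨z, hz⟩ := S.exists_coord_eq hx
  refine ⟨S.coord k z, ?_, z, rfl⟩
  rw [hz, Metric.mem_ball, dist_eq_norm]
  linarith

theorem isInducing_coord (S : ScStructure 𝕜 E) : IsInducing (fun (x : E) k => S.coord k x) :=
  IsInducing.subtypeVal.comp S.equiv.symm.toHomeomorph.isInducing

theorem nhds_eq_iInf (S : ScStructure 𝕜 E) (x : E) :
    𝓝 x = ⨅ k, Filter.comap (S.coord k) (𝓝 (S.coord k x)) := by
  rw [S.isInducing_coord.nhds_eq_comap, nhds_pi, Filter.pi, Filter.comap_iInf]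
  simp only [Filter.comap_comap]
  rfl

theorem continuousAt_of_coord {X : Type*} [TopologicalSpace X] (S : ScStructure 𝕜 E) {f : X → E}
    {x : X} (h : ∀ k, ContinuousAt (fun y => S.coord k (f y)) x) : ContinuousAt f x := by
  rw [ContinuousAt, S.nhds_eq_iInf, Filter.tendsto_iInf]
  exact fun k => Filter.tendsto_comap_iff.2 (h k)

/-- The ball around `x` for the norm of level `p`. -/
def ball (S : ScStructure 𝕜 E) (x : E) (p : ℕ) (r : ℝ) : Set E :=
  {y | ‖S.coord p y - S.coord p x‖ < r}

theorem isOpen_ball (S : ScStructure 𝕜 E) (x : E) (p : ℕ) (r : ℝ) : IsOpen (S.ball x p r) :=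
  isOpen_lt (((S.coord p).continuous.sub continuous_const).norm) continuous_const

theorem mem_ball_self (S : ScStructure 𝕜 E) (x : E) (p : ℕ) {r : ℝ} (hr : 0 < r) :
    x ∈ S.ball x p r := by
  simpa [ball] using hr

theorem ball_mem_nhds (S : ScStructure 𝕜 E) (x : E) (p : ℕ) {r : ℝ} (hr : 0 < r) :
    S.ball x p r ∈ 𝓝 x :=
  (S.isOpen_ball x p r).mem_nhds (S.mem_ball_self x p hr)

/-- The norms increase with the level, so a single norm suffices to describe a basic neighbourhood.
The level `p` found here later bounds from below the levels at which the neighbourhood is visible.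
-/
theorem exists_ball_subset (S : ScStructure 𝕜 E) {x : E} {V : Set E} (hV : V ∈ 𝓝 x) :
    ∃ (p : ℕ) (r : ℝ), 0 < r ∧ S.ball x p r ⊆ V := by
  rw [S.nhds_eq_iInf, Filter.mem_iInf_of_directed] at hV
  · obtain ⟨p, t, ht, hV⟩ := hV
    obtain ⟨r, hr, hrt⟩ := Metric.mem_nhds_iff.1 ht
    refine ⟨p, r, hr, fun y hy => hV (hrt ?_)⟩
    rw [Metric.mem_ball, dist_eq_norm]
    exact hy
  · refine (antitone_nat_of_succ_le fun n => ?_).directed_ge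
    rw [← Filter.tendsto_iff_comap]
    have h : Filter.Tendsto (fun y => S.chain.ι n (S.coord (n + 1) y))
        (Filter.comap (S.coord (n + 1)) (𝓝 (S.coord (n + 1) x)))
        (𝓝 (S.chain.ι n (S.coord (n + 1) x))) :=
      ((S.chain.ι n).continuous.tendsto _).comp Filter.tendsto_comap
    simpa only [S.ι_coord] using h

theorem norm_coord_le_of_mem_ball (S : ScStructure 𝕜 E) {x y : E} {p : ℕ} {r : ℝ}
    (h : y ∈ S.ball x p r) : ‖S.coord p y‖ ≤ ‖S.coord p x‖ + r := by
  have h1 : ‖S.coord p y - S.coord p x‖ < r := h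
  have := norm_le_norm_add_norm_sub (S.coord p x) (S.coord p y)
  rw [norm_sub_rev] at this
  linarith

theorem equivalent_rescale (c : ScContext) (S : ScStructure 𝕜 E) {m : ℕ → ℕ}
    (hm : c.Admissible m) : Equivalent c S (S.rescale m hm.1) := by
  constructor
  · refine ⟨m, fun j => j, hm, c.admissible_id,
      ⟨fun j => ContinuousLinearMap.id 𝕜 (S.chain.X (m j)), fun j x => ?_⟩,
      fun j => Function.injective_id, fun j x => rfl⟩
    change S.chain.incl _ x = (S.chain.rescale m hm.1).incl _ x
    rw [ScChain.rescale_incl]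
  · refine ⟨fun j => j, m, c.admissible_id, hm,
      ⟨fun j => ContinuousLinearMap.id 𝕜 (S.chain.X (m j)), fun j x => ?_⟩,
      fun j => Function.injective_id, fun j x => rfl⟩
    change (S.chain.rescale m hm.1).incl _ x = S.chain.incl _ x
    rw [ScChain.rescale_incl]

theorem equivalent_refl (c : ScContext) (S : ScStructure 𝕜 E) : Equivalent c S S := by
  have h : WeaklyEmbeds c S S :=
    ⟨fun j => j, fun j => j, c.admissible_id, c.admissible_id,
      ⟨fun j => ContinuousLinearMap.id 𝕜 (S.chain.X j), fun j x => rfl⟩,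
      fun j => Function.injective_id, fun j x => rfl⟩
  exact ⟨h, h⟩

/-- The identity extends to the levels of weakly embedded structures, with the levels shifted by
an admissible sequence. -/
theorem WeaklyEmbeds.exists_clm {c : ScContext} {S T : ScStructure 𝕜 E} (h : WeaklyEmbeds c S T) :
    ∃ m, c.Admissible m ∧ ∀ i, ∃ J : S.chain.X (m i) →L[𝕜] T.chain.X i,
      ∀ x, J (S.coord (m i) x) = T.coord i x := by
  obtain ⟨k, l, hk, hl, J, -, hJ⟩ := h
  refine ⟨k, hk, fun i => ⟨(T.chain.incl (hl.1.le_apply (x := i))).comp (J.map i), fun x => ?_⟩⟩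
  rw [ContinuousLinearMap.comp_apply, hJ, T.incl_coord]

end ScStructure

/-! ### From continuous maps linear on a dense subspace to norm continuous families of operators. -/

section Linearization

/-- The device by which identities known only on `E` pass to open subsets of the levels. -/
theorem Dense.eqOn_of_isOpen {X Y : Type*} [TopologicalSpace X] [TopologicalSpace Y] [T2Space Y]
    {s G : Set X} {f g : X → Y} (hs : Dense s) (hG : IsOpen G) (hf : ContinuousOn f G)
    (hg : ContinuousOn g G) (h : ∀ x ∈ G, x ∈ s → f x = g x) : EqOn f g G :=
  Set.EqOn.of_subset_closure (s := G ∩ s) (fun x hx => h x hx.1 hx.2) hf hg inter_subset_left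
    (hs.open_subset_closure_inter hG)

variable {𝕜 : Type*} [RCLike 𝕜]
variable {X X₁ Y Z : Type*} [NormedAddCommGroup X]
variable [NormedAddCommGroup X₁] [NormedSpace 𝕜 X₁]
variable [NormedAddCommGroup Y] [NormedSpace 𝕜 Y]
variable [NormedAddCommGroup Z] [NormedSpace 𝕜 Z]

/-- A jointly continuous family of linear maps becomes norm continuous after composition with a
compact operator. -/
theorem exists_continuousOn_comp_compact {W : Set X} (hW : IsOpen W) (A : X → X₁ →ₗ[𝕜] Y)
    (hA : ContinuousOn (fun p : X × X₁ => A p.1 p.2) (W ×ˢ univ)) {T : Z →L[𝕜] X₁}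
    (hT : IsCompactOperator T) :
    ∃ Φ : X → Z →L[𝕜] Y, ContinuousOn Φ W ∧ ∀ x ∈ W, ∀ z, Φ x z = A x (T z) := by
  classical
  have hcont : ∀ x ∈ W, Continuous (A x) := fun x hx => by
    rw [← continuousOn_univ]
    exact hA.comp (f := fun u => (x, u)) (by fun_prop) fun u _ => ⟨hx, mem_univ _⟩
  let Φ : X → Z →L[𝕜] Y := fun x =>
    if hx : x ∈ W then (⟨A x, hcont x hx⟩ : X₁ →L[𝕜] Y).comp T else 0
  have hΦ : ∀ x ∈ W, ∀ z, Φ x z = A x (T z) := fun x hx z => by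
    simp only [Φ, dif_pos hx]; rfl
  refine ⟨Φ, fun x₀ hx₀ => ContinuousAt.continuousWithinAt ?_, hΦ⟩
  rw [Metric.continuousAt_iff']
  intro ε hε
  obtain ⟨K, hK, hTK⟩ := hT.image_closedBall_subset_compact (f := (T : Z →ₗ[𝕜] X₁)) 1
  -- Joint continuity is uniform over the compact set `K`, which contains the image of the unit ball
  -- under `T`; this turns strong continuity into norm continuity.
  have hloc : ∀ᶠ x in 𝓝 x₀, ∀ u ∈ K, x ∈ W → ‖A x u - A x₀ u‖ < ε / 2 := by
    refine hK.eventually_forall_of_forall_eventually fun u _ => ?_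
    have h1 : ContinuousAt (fun p : X × X₁ => A p.1 p.2) (x₀, u) :=
      hA.continuousAt ((hW.prod isOpen_univ).mem_nhds ⟨hx₀, mem_univ _⟩)
    have h2 : ContinuousAt (fun p : X × X₁ => ‖A p.1 p.2 - A x₀ p.2‖) (x₀, u) :=
      (h1.sub ((hcont x₀ hx₀).comp continuous_snd).continuousAt).norm
    have h3 := h2.eventually_lt_const (u := ε / 2) (by simpa using hε)
    exact h3.mono fun p hp _ => hp
  filter_upwards [hloc, hW.mem_nhds hx₀] with x hx hxW
  rw [dist_eq_norm]
  refine lt_of_le_of_lt ?_ (half_lt_self hε)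
  refine ContinuousLinearMap.opNorm_le_of_unit_norm (half_pos hε).le fun z hz => ?_
  rw [sub_apply, hΦ x hxW, hΦ x₀ hx₀]
  exact (hx _ (hTK ⟨z, by simp [hz], rfl⟩) hxW).le

/-- A continuous map on an open subset of `X × X₁` that is linear in the second variable at the
points of a dense subspace extends to a linear family; composed with a compact operator, the
family is norm continuous. -/
theorem exists_continuousOn_linear_extension {D D₁ : Type*} [AddCommGroup D₁] [Module 𝕜 D₁]
    {i : D → X} (hi : DenseRange i) {i₁ : D₁ →ₗ[𝕜] X₁} (hi₁ : DenseRange i₁)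
    {O : Set (X × X₁)} (hO : IsOpen O) {F : X × X₁ → Y} (hF : ContinuousOn F O)
    (φ : D → D₁ →ₗ[𝕜] Y) (h : ∀ d d₁, (i d, i₁ d₁) ∈ O → F (i d, i₁ d₁) = φ d d₁)
    {T : Z →L[𝕜] X₁} (hT : IsCompactOperator T) :
    ∃ Φ : X → Z →L[𝕜] Y, ContinuousOn Φ {x | (x, (0 : X₁)) ∈ O} ∧
      ∀ d, (i d, (0 : X₁)) ∈ O → ∀ z d₁, T z = i₁ d₁ → Φ (i d) z = φ d d₁ := by
  classical
  have hsmul : ∀ (a : 𝕜) (x : X) (u : X₁), (x, u) ∈ O → (x, a • u) ∈ O →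
      F (x, a • u) = a • F (x, u) := by
    intro a x u h1 h2
    have hG : IsOpen (O ∩ (fun p : X × X₁ => (p.1, a • p.2)) ⁻¹' O) :=
      hO.inter (hO.preimage (by fun_prop))
    refine (hi.prodMap hi₁).eqOn_of_isOpen (f := fun p => F (p.1, a • p.2))
      (g := fun p => a • F p) hG
      (hF.comp (f := fun p : X × X₁ => (p.1, a • p.2)) (by fun_prop) fun p hp => hp.2)
      ((hF.mono inter_subset_left).const_smul a) ?_ (x := (x, u)) ⟨h1, h2⟩
    rintro _ ⟨hp1, hp2⟩ ⟨⟨d, d₁⟩, rfl⟩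
    have hp2' : (i d, i₁ (a • d₁)) ∈ O := by rw [map_smul]; exact hp2
    have := h d (a • d₁) hp2'
    rw [map_smul, map_smul] at this
    exact this.trans (congrArg (a • ·) (h d d₁ hp1).symm)
  have hadd : ∀ (x : X) (u w : X₁), (x, u) ∈ O → (x, w) ∈ O → (x, u + w) ∈ O →
      F (x, u + w) = F (x, u) + F (x, w) := by
    intro x u w h1 h2 h3
    have c1 : Continuous (fun p : X × X₁ × X₁ => (p.1, p.2.1)) := by fun_prop
    have c2 : Continuous (fun p : X × X₁ × X₁ => (p.1, p.2.2)) := by fun_prop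
    have c3 : Continuous (fun p : X × X₁ × X₁ => (p.1, p.2.1 + p.2.2)) := by fun_prop
    have hG := ((hO.preimage c1).inter (hO.preimage c2)).inter (hO.preimage c3)
    refine (hi.prodMap (hi₁.prodMap hi₁)).eqOn_of_isOpen
      (f := fun p : X × X₁ × X₁ => F (p.1, p.2.1 + p.2.2))
      (g := fun p : X × X₁ × X₁ => F (p.1, p.2.1) + F (p.1, p.2.2)) hG
      (hF.comp c3.continuousOn fun p hp => hp.2)
      ((hF.comp c1.continuousOn fun p hp => hp.1.1).add
        (hF.comp c2.continuousOn fun p hp => hp.1.2)) ?_ (x := (x, u, w)) ⟨⟨h1, h2⟩, h3⟩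
    rintro _ ⟨⟨hp1, hp2⟩, hp3⟩ ⟨⟨d, d₁, d₂⟩, rfl⟩
    have hp3' : (i d, i₁ (d₁ + d₂)) ∈ O := by rw [map_add]; exact hp3
    have := h d (d₁ + d₂) hp3'
    rw [map_add, map_add] at this
    exact this.trans (congrArg₂ (· + ·) (h d d₁ hp1).symm (h d d₂ hp2).symm)
  have hsmall : ∀ (x : X), (x, (0 : X₁)) ∈ O → ∀ u : X₁, ∀ᶠ t : 𝕜 in 𝓝[≠] 0, (x, t • u) ∈ O := by
    intro x hx u
    have hc : ContinuousAt (fun t : 𝕜 => (x, t • u)) 0 := by fun_prop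
    refine (hc.eventually (hO.mem_nhds ?_)).filter_mono nhdsWithin_le_nhds
    simpa using hx
  -- Extension by homogeneity: shrink `u` into the domain, apply `F`, scale back. By `hsmul` the
  -- result does not depend on the scalar, and one exists whenever `(x, 0) ∈ O`; the value zero is
  -- never used there.
  let A₀ : X → X₁ → Y := fun x u =>
    if hx : ∃ t : 𝕜, t ≠ 0 ∧ (x, t • u) ∈ O then (hx.choose)⁻¹ • F (x, hx.choose • u) else 0
  have hA₀ : ∀ (x : X) (u : X₁) (t : 𝕜), t ≠ 0 → (x, t • u) ∈ O →
      A₀ x u = t⁻¹ • F (x, t • u) := by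
    intro x u t ht htO
    have hx : ∃ t : 𝕜, t ≠ 0 ∧ (x, t • u) ∈ O := ⟨t, ht, htO⟩
    simp only [A₀, dif_pos hx]
    obtain ⟨hs, hsO⟩ := hx.choose_spec
    set s := hx.choose
    have h1 : s • u = (s * t⁻¹) • (t • u) := by
      rw [smul_smul, mul_assoc, inv_mul_cancel₀ ht, mul_one]
    have h2 := hsmul (s * t⁻¹) x (t • u) htO (h1 ▸ hsO)
    rw [← h1] at h2
    rw [h2, smul_smul, ← mul_assoc, inv_mul_cancel₀ hs, one_mul]
  have hne : ∀ᶠ t : 𝕜 in 𝓝[≠] 0, t ≠ 0 := eventually_mem_nhdsWithin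
  let W : Set X := {x | (x, (0 : X₁)) ∈ O}
  have hW : IsOpen W := hO.preimage (f := fun x : X => (x, (0 : X₁))) (by fun_prop)
  have hlin : ∀ x ∈ W, (∀ u w, A₀ x (u + w) = A₀ x u + A₀ x w) ∧
      ∀ (a : 𝕜) u, A₀ x (a • u) = a • A₀ x u := by
    intro x hx
    constructor
    · intro u w
      obtain ⟨t, ⟨⟨ht, hu⟩, hw⟩, huw⟩ := (((hne.and (hsmall x hx u)).and (hsmall x hx w)).and
        (hsmall x hx (u + w))).exists
      rw [hA₀ x u t ht hu, hA₀ x w t ht hw, hA₀ x (u + w) t ht huw, ← smul_add,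
        ← hadd x _ _ hu hw (by rwa [← smul_add]), smul_add]
    · intro a u
      obtain ⟨t, ⟨ht, hu⟩, hau⟩ := ((hne.and (hsmall x hx u)).and (hsmall x hx (a • u))).exists
      rw [hA₀ x u t ht hu, hA₀ x (a • u) t ht hau, smul_comm t a, hsmul a x _ hu, smul_comm]
      rwa [smul_comm]
  let A : X → X₁ →ₗ[𝕜] Y := fun x =>
    if hx : x ∈ W then
      { toFun := A₀ x, map_add' := (hlin x hx).1, map_smul' := (hlin x hx).2 } else 0
  have hA : ∀ x ∈ W, ∀ u, A x u = A₀ x u := fun x hx u => by simp only [A, dif_pos hx]; rfl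
  have hAc : ContinuousOn (fun p : X × X₁ => A p.1 p.2) (W ×ˢ univ) := by
    rintro ⟨x, u⟩ ⟨hx, -⟩
    -- Continuity is local, so one scalar `t`, fixed at the point, serves all nearby points.
    obtain ⟨t, ht, hu⟩ := (hne.and (hsmall x hx u)).exists
    have hc : Continuous (fun p : X × X₁ => (p.1, t • p.2)) := by fun_prop
    have h1 : ContinuousAt (fun p : X × X₁ => t⁻¹ • F (p.1, t • p.2)) (x, u) :=
      (ContinuousAt.comp (f := fun p : X × X₁ => (p.1, t • p.2)) (x := (x, u))
        (hF.continuousAt (hO.mem_nhds hu)) hc.continuousAt).const_smul t⁻¹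
    refine (h1.congr ?_).continuousWithinAt
    filter_upwards [(hO.preimage hc).mem_nhds hu,
      (hW.preimage (continuous_fst (Y := X₁))).mem_nhds hx] with p hp hpW
    rw [hA _ hpW, hA₀ p.1 p.2 t ht hp]
  obtain ⟨Φ, hΦc, hΦ⟩ := exists_continuousOn_comp_compact hW A hAc hT
  refine ⟨Φ, hΦc, fun d hd z d₁ hz => ?_⟩
  rw [hΦ _ hd, hz, hA _ hd]
  obtain ⟨t, ht, hu⟩ := (hne.and (hsmall (i d) hd (i₁ d₁))).exists
  rw [hA₀ _ _ t ht hu, ← map_smul, h d (t • d₁) (by rwa [map_smul]), map_smul, smul_smul,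
    inv_mul_cancel₀ ht, one_smul]

end Linearization

/-! ### Local families in fixed sc-structures: calculus of levels and tame estimates. -/

section LocalFamilies

variable {𝕜 : Type v} [RCLike 𝕜]
variable {E : Type u} [AddCommGroup E] [Module 𝕜 E] [TopologicalSpace E]
variable {E' : Type u'} [AddCommGroup E'] [Module 𝕜 E'] [TopologicalSpace E']
variable {E₁ : Type u₁} [AddCommGroup E₁] [Module 𝕜 E₁] [TopologicalSpace E₁]
variable {E₂ : Type u₂} [AddCommGroup E₂] [Module 𝕜 E₂] [TopologicalSpace E₂]
variable {E₃ : Type u₃} [AddCommGroup E₃] [Module 𝕜 E₃] [TopologicalSpace E₃]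
variable {S : ScStructure 𝕜 E} {S' : ScStructure 𝕜 E'} {S₁ : ScStructure 𝕜 E₁}
variable {S₂ : ScStructure 𝕜 E₂} {S₃ : ScStructure 𝕜 E₃}

/-- Over `V`, the family `φ` extends to a norm continuous family of bounded operators from level
`l` to level `k`, parametrized by an open subset of level `m` that meets `E` in `V`. -/
def ExtendsToLevels (S : ScStructure 𝕜 E) (S₁ : ScStructure 𝕜 E₁) (S₂ : ScStructure 𝕜 E₂)
    (V : Set E) (φ : E → E₁ →ₗ[𝕜] E₂) (m l k : ℕ) : Prop :=
  ∃ (W : Set (S.chain.X m)) (Φ : S.chain.X m → S₁.chain.X l →L[𝕜] S₂.chain.X k),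
    IsOpen W ∧ (∀ x, S.coord m x ∈ W ↔ x ∈ V) ∧ ContinuousOn Φ W ∧
      ∀ x ∈ V, ∀ u, Φ (S.coord m x) (S₁.coord l u) = S₂.coord k (φ x u)

/-- Over `V`, the map `f` extends to a continuous map from an open subset of level `m` that meets
`E` in `V` to level `k`. -/
def MapExtendsToLevels (S : ScStructure 𝕜 E) (S' : ScStructure 𝕜 E') (V : Set E) (f : E → E')
    (m k : ℕ) : Prop :=
  ∃ (W : Set (S.chain.X m)) (F : S.chain.X m → S'.chain.X k),
    IsOpen W ∧ (∀ x, S.coord m x ∈ W ↔ x ∈ V) ∧ ContinuousOn F W ∧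
      ∀ x ∈ V, F (S.coord m x) = S'.coord k (f x)

section Levels

variable {V V' : Set E} {φ φ' : E → E₁ →ₗ[𝕜] E₂} {ψ : E → E₂ →ₗ[𝕜] E₃} {m l k j m' l' k' : ℕ}

theorem ExtendsToLevels.mono (h : ExtendsToLevels S S₁ S₂ V φ m l k) (hm : m ≤ m') (hl : l ≤ l')
    (hk : k' ≤ k) : ExtendsToLevels S S₁ S₂ V φ m' l' k' := by
  obtain ⟨W, Φ, hW, hWV, hΦ, hφ⟩ := h
  refine ⟨S.chain.incl hm ⁻¹' W,
    fun x => (S₂.chain.incl hk).comp ((Φ (S.chain.incl hm x)).comp (S₁.chain.incl hl)),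
    hW.preimage (S.chain.incl hm).continuous, fun x => ?_, ?_, fun x hx u => ?_⟩
  · rw [mem_preimage, S.incl_coord, hWV]
  · exact continuousOn_const.clm_comp
      ((hΦ.comp (S.chain.incl hm).continuous.continuousOn fun x hx => hx).clm_comp
        continuousOn_const)
  · rw [ContinuousLinearMap.comp_apply, ContinuousLinearMap.comp_apply, S.incl_coord,
      S₁.incl_coord, hφ x hx, S₂.incl_coord]

/-- The domain at level `m` must meet `E` in exactly the given set, so one cannot pass to an
arbitrary smaller neighbourhood. A ball of level `p ≤ m` is cut out by an open condition at level
`m`. -/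
theorem ExtendsToLevels.restrict_ball (h : ExtendsToLevels S S₁ S₂ V φ m l k) {x₀ : E} {p : ℕ}
    {r : ℝ} (hV : S.ball x₀ p r ⊆ V) (hp : p ≤ m) :
    ExtendsToLevels S S₁ S₂ (S.ball x₀ p r) φ m l k := by
  obtain ⟨W, Φ, hW, hWV, hΦ, hφ⟩ := h
  refine ⟨W ∩ {x | ‖S.chain.incl hp x - S.coord p x₀‖ < r}, Φ, hW.inter ?_, fun x => ?_,
    hΦ.mono inter_subset_left, fun x hx => hφ x (hV hx)⟩
  · exact isOpen_lt (((S.chain.incl hp).continuous.sub continuous_const).norm) continuous_const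
  · rw [mem_inter_iff, hWV, mem_ofPred_eq, S.incl_coord]
    exact ⟨fun hx => hx.2, fun hx => ⟨hV hx, hx⟩⟩

theorem ExtendsToLevels.comp (hψ : ExtendsToLevels S S₂ S₃ V' ψ m k j)
    (hφ : ExtendsToLevels S S₁ S₂ V φ m l k) :
    ExtendsToLevels S S₁ S₃ (V ∩ V') (fun x => (ψ x).comp (φ x)) m l j := by
  obtain ⟨W, Φ, hW, hWV, hΦ, hφ⟩ := hφ
  obtain ⟨W', Ψ, hW', hWV', hΨ, hψ⟩ := hψ
  refine ⟨W ∩ W', fun x => (Ψ x).comp (Φ x), hW.inter hW', fun x => ?_,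
    (hΨ.mono inter_subset_right).clm_comp (hΦ.mono inter_subset_left), fun x hx u => ?_⟩
  · rw [mem_inter_iff, hWV, hWV', mem_inter_iff]
  · rw [ContinuousLinearMap.comp_apply, hφ x hx.1, hψ x hx.2]; rfl

theorem ExtendsToLevels.add (hφ : ExtendsToLevels S S₁ S₂ V φ m l k)
    (hφ' : ExtendsToLevels S S₁ S₂ V' φ' m l k) :
    ExtendsToLevels S S₁ S₂ (V ∩ V') (fun x => φ x + φ' x) m l k := by
  obtain ⟨W, Φ, hW, hWV, hΦ, hφ⟩ := hφ
  obtain ⟨W', Φ', hW', hWV', hΦ', hφ'⟩ := hφ'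
  refine ⟨W ∩ W', fun x => Φ x + Φ' x, hW.inter hW', fun x => ?_,
    (hΦ.mono inter_subset_left).add (hΦ'.mono inter_subset_right), fun x hx u => ?_⟩
  · rw [mem_inter_iff, hWV, hWV', mem_inter_iff]
  · rw [add_apply, hφ x hx.1, hφ' x hx.2, LinearMap.add_apply, map_add]

theorem ExtendsToLevels.pullback (hφ : ExtendsToLevels S S₁ S₂ V φ m l k) {V' : Set E'}
    {f : E' → E} {n : ℕ} (hf : MapExtendsToLevels S' S V' f n m) :
    ExtendsToLevels S' S₁ S₂ (V' ∩ f ⁻¹' V) (fun x => φ (f x)) n l k := by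
  obtain ⟨W, Φ, hW, hWV, hΦ, hφ⟩ := hφ
  obtain ⟨W', F, hW', hWV', hF, hf⟩ := hf
  refine ⟨W' ∩ F ⁻¹' W, fun x => Φ (F x), hF.isOpen_inter_preimage hW' hW, fun x => ?_,
    hΦ.comp (hF.mono inter_subset_left) fun x hx => hx.2, fun x hx u => ?_⟩
  · rw [mem_inter_iff, hWV', mem_inter_iff, mem_preimage, mem_preimage]
    refine and_congr_right fun hx => ?_
    rw [hf x hx, hWV]
  · dsimp only
    rw [hf x hx.1, hφ _ hx.2]

end Levels

/-- A tame estimate for a family of linear maps: the norm of level `r` of the vector controls the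
norm of level `k + r` of the parameter. -/
def TameFamilyEstimate (S : ScStructure 𝕜 E) (S₁ : ScStructure 𝕜 E₁) (S₂ : ScStructure 𝕜 E₂)
    (V : Set E) (φ : E → E₁ →ₗ[𝕜] E₂) : Prop :=
  ∃ r : ℕ, ∀ k, ∃ C : ℝ, 0 ≤ C ∧ ∀ x ∈ V, ∀ u, ‖S₂.coord k (φ x u)‖ ≤
    C * ((1 + ‖S.coord (k + r) x‖) * ‖S₁.coord r u‖ + ‖S₁.coord (k + r) u‖)

/-- A tame estimate for a smoothing family of linear maps. -/
def TameSmoothingEstimate (S : ScStructure 𝕜 E) (S₁ : ScStructure 𝕜 E₁) (S₂ : ScStructure 𝕜 E₂)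
    (V : Set E) (κ : E → E₁ →ₗ[𝕜] E₂) : Prop :=
  ∃ r : ℕ, ∀ k, ∃ C : ℝ, 0 ≤ C ∧ ∀ x ∈ V, ∀ u, ‖S₂.coord k (κ x u)‖ ≤
    C * ((1 + ‖S.coord (k + r) x‖) * ‖S₁.coord r u‖)

/-- A tame estimate for a map. -/
def TameMapEstimate (S : ScStructure 𝕜 E) (S' : ScStructure 𝕜 E') (V : Set E) (f : E → E') :
    Prop :=
  ∃ r : ℕ, ∀ k, ∃ C : ℝ, 0 ≤ C ∧ ∀ x ∈ V, ‖S'.coord k (f x)‖ ≤ C * (1 + ‖S.coord (k + r) x‖)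

/-- Near `x₀`, the family `φ` is an sc⁰ family of morphisms, expressed in fixed sc-structures. -/
def IsLocalFamily (c : ScContext) (S : ScStructure 𝕜 E) (S₁ : ScStructure 𝕜 E₁)
    (S₂ : ScStructure 𝕜 E₂) (x₀ : E) (φ : E → E₁ →ₗ[𝕜] E₂) : Prop :=
  (∃ V ∈ 𝓝 x₀, ∃ m, c.Admissible m ∧ ∀ k, ExtendsToLevels S S₁ S₂ V φ (m k) (m k) k) ∧
    (c = ScContext.tame → ∃ V ∈ 𝓝 x₀, TameFamilyEstimate S S₁ S₂ V φ)

/-- Near `x₀`, the family `κ` is strongly smoothing, expressed in fixed sc-structures. -/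
def IsLocalSmoothing (c : ScContext) (S : ScStructure 𝕜 E) (S₁ : ScStructure 𝕜 E₁)
    (S₂ : ScStructure 𝕜 E₂) (x₀ : E) (κ : E → E₁ →ₗ[𝕜] E₂) : Prop :=
  (∃ V ∈ 𝓝 x₀, ∃ m n, c.Admissible m ∧ ∀ k, ExtendsToLevels S S₁ S₂ V κ (m k) n k) ∧
    (c = ScContext.tame → ∃ V ∈ 𝓝 x₀, TameSmoothingEstimate S S₁ S₂ V κ)

/-- Near `x₀`, the map `f` is an sc⁰ map, expressed in fixed sc-structures. -/
def IsLocalMap (c : ScContext) (S : ScStructure 𝕜 E) (S' : ScStructure 𝕜 E') (x₀ : E)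
    (f : E → E') : Prop :=
  (∃ V ∈ 𝓝 x₀, ∃ m, c.Admissible m ∧ ∀ k, MapExtendsToLevels S S' V f (m k) k) ∧
    (c = ScContext.tame → ∃ V ∈ 𝓝 x₀, TameMapEstimate S S' V f)

theorem IsLocalMap.continuousAt {c : ScContext} {x₀ : E} {f : E → E'}
    (h : IsLocalMap c S S' x₀ f) : ContinuousAt f x₀ := by
  obtain ⟨V, hV, m, -, h⟩ := h.1
  refine S'.continuousAt_of_coord fun k => ?_
  obtain ⟨W, F, hW, hWV, hF, hf⟩ := h k
  have h1 : ContinuousAt (fun x => F (S.coord (m k) x)) x₀ :=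
    ContinuousAt.comp (f := S.coord (m k))
      (hF.continuousAt (hW.mem_nhds ((hWV x₀).2 (mem_of_mem_nhds hV))))
      (S.coord (m k)).continuous.continuousAt
  exact h1.congr (Filter.mem_of_superset hV hf)

/-- Tame estimates of composites contain products of two parameter norms. One factor has a fixed
level and is bounded near `x₀`, which keeps the result affine in the norm of high level. -/
theorem ScStructure.exists_mem_nhds_norm_le (S : ScStructure 𝕜 E) (x₀ : E) (s : ℕ) :
    ∃ V ∈ 𝓝 x₀, ∃ B : ℝ, 0 ≤ B ∧ ∀ x ∈ V, ∀ t ≤ s, ‖S.coord t x‖ ≤ B :=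
  ⟨S.ball x₀ s 1, S.ball_mem_nhds x₀ s one_pos, ‖S.coord s x₀‖ + 1, by positivity,
    fun _ hx _ ht => (S.norm_coord_mono ht _).trans (S.norm_coord_le_of_mem_ball hx)⟩

variable {c : ScContext} {x₀ : E} {φ φ' κ κ' : E → E₁ →ₗ[𝕜] E₂} {ψ μ : E → E₂ →ₗ[𝕜] E₃}

/-- In the tame estimate, the high norm of `x` multiplies only the level `r'` norm of `φ x u`. That
norm involves `x` through level `r' + r` alone, where it is at most `B`. -/
theorem IsLocalFamily.comp (hψ : IsLocalFamily c S S₂ S₃ x₀ ψ)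
    (hφ : IsLocalFamily c S S₁ S₂ x₀ φ) :
    IsLocalFamily c S S₁ S₃ x₀ (fun x => (ψ x).comp (φ x)) := by
  constructor
  · obtain ⟨V, hV, m, hm, h⟩ := hφ.1
    obtain ⟨V', hV', m', hm', h'⟩ := hψ.1
    refine ⟨V ∩ V', Filter.inter_mem hV hV', _, hm.comp hm', fun k => ?_⟩
    exact ((h' k).mono hm.1.le_apply le_rfl le_rfl).comp (h (m' k))
  · intro hc
    obtain ⟨V, hV, r, h⟩ := hφ.2 hc
    obtain ⟨V', hV', r', h'⟩ := hψ.2 hc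
    obtain ⟨V'', hV'', B, hB, hB'⟩ := S.exists_mem_nhds_norm_le x₀ (r' + r)
    refine ⟨V ∩ V' ∩ V'', Filter.inter_mem (Filter.inter_mem hV hV') hV'', r' + r, fun k => ?_⟩
    obtain ⟨C₀, hC₀, h₀⟩ := h r'
    obtain ⟨C₁, hC₁, h₁⟩ := h (k + r')
    obtain ⟨C₂, hC₂, h₂⟩ := h' k
    refine ⟨C₂ * (C₀ * (2 + B) + C₁), by positivity, fun x hx u => ?_⟩
    have e₀ := h₀ x hx.1.1 u
    have e₁ := h₁ x hx.1.1 u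
    have e₂ := h₂ x hx.1.2 (φ x u)
    have i₀ := hB' x hx.2 (r' + r) le_rfl
    have i₁ := S.norm_coord_mono (show k + r' ≤ k + (r' + r) by omega) x
    have i₂ := S.norm_coord_mono (show k + r' + r ≤ k + (r' + r) by omega) x
    have i₃ := S₁.norm_coord_mono (show r ≤ r' + r by omega) u
    have i₄ := S₁.norm_coord_mono (show k + r' + r ≤ k + (r' + r) by omega) u
    set X := ‖S.coord (k + (r' + r)) x‖
    set P := ‖S₁.coord (r' + r) u‖
    set Q := ‖S₁.coord (k + (r' + r)) u‖
    have hX : 0 ≤ X := norm_nonneg _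
    have hP : 0 ≤ P := norm_nonneg _
    have hQ : 0 ≤ Q := norm_nonneg _
    calc ‖S₃.coord k (ψ x (φ x u))‖
        ≤ C₂ * ((1 + X) * (C₀ * ((1 + B) * P + P)) + C₁ * ((1 + X) * P + Q)) := by
          refine e₂.trans ?_
          gcongr
          · refine e₀.trans ?_
            gcongr
          · refine e₁.trans ?_
            gcongr
      _ ≤ C₂ * (C₀ * (2 + B) + C₁) * ((1 + X) * P + Q) := by
          have : 0 ≤ C₂ * C₀ * (2 + B) * Q := by positivity
          linarith

theorem IsLocalFamily.add (hφ : IsLocalFamily c S S₁ S₂ x₀ φ)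
    (hφ' : IsLocalFamily c S S₁ S₂ x₀ φ') :
    IsLocalFamily c S S₁ S₂ x₀ (fun x => φ x + φ' x) := by
  constructor
  · obtain ⟨V, hV, m, hm, h⟩ := hφ.1
    obtain ⟨V', hV', m', hm', h'⟩ := hφ'.1
    refine ⟨V ∩ V', Filter.inter_mem hV hV', _, hm.max hm', fun k => ?_⟩
    exact ((h k).mono (le_max_left _ _) (le_max_left _ _) le_rfl).add
      ((h' k).mono (le_max_right _ _) (le_max_right _ _) le_rfl)
  · intro hc
    obtain ⟨V, hV, r, h⟩ := hφ.2 hc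
    obtain ⟨V', hV', r', h'⟩ := hφ'.2 hc
    refine ⟨V ∩ V', Filter.inter_mem hV hV', max r r', fun k => ?_⟩
    obtain ⟨C₁, hC₁, h₁⟩ := h k
    obtain ⟨C₂, hC₂, h₂⟩ := h' k
    refine ⟨C₁ + C₂, by positivity, fun x hx u => ?_⟩
    rw [LinearMap.add_apply, map_add, add_mul]
    refine (norm_add_le _ _).trans (add_le_add ((h₁ x hx.1 u).trans ?_) ((h₂ x hx.2 u).trans ?_))
    · have := S.norm_coord_mono (show k + r ≤ k + max r r' by omega) x
      have := S₁.norm_coord_mono (show r ≤ max r r' by omega) u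
      have := S₁.norm_coord_mono (show k + r ≤ k + max r r' by omega) u
      gcongr
    · have := S.norm_coord_mono (show k + r' ≤ k + max r r' by omega) x
      have := S₁.norm_coord_mono (show r' ≤ max r r' by omega) u
      have := S₁.norm_coord_mono (show k + r' ≤ k + max r r' by omega) u
      gcongr

theorem IsLocalFamily.pullback {x₀ : E'} {f : E' → E} (hf : IsLocalMap c S' S x₀ f)
    (hφ : IsLocalFamily c S S₁ S₂ (f x₀) φ) :
    IsLocalFamily c S' S₁ S₂ x₀ (fun x => φ (f x)) := by
  constructor
  · obtain ⟨V, hV, m, hm, h⟩ := hφ.1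
    obtain ⟨V', hV', m', hm', h'⟩ := hf.1
    refine ⟨V' ∩ f ⁻¹' V, Filter.inter_mem hV' (hf.continuousAt hV), _, hm'.comp hm, fun k => ?_⟩
    exact (h k).pullback (h' (m k)) |>.mono le_rfl hm'.1.le_apply le_rfl
  · intro hc
    obtain ⟨V, hV, r, h⟩ := hφ.2 hc
    obtain ⟨V', hV', r', h'⟩ := hf.2 hc
    refine ⟨V' ∩ f ⁻¹' V, Filter.inter_mem hV' (hf.continuousAt hV), r + r', fun k => ?_⟩
    obtain ⟨C₁, hC₁, h₁⟩ := h k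
    obtain ⟨C₂, hC₂, h₂⟩ := h' (k + r)
    refine ⟨C₁ * (1 + C₂), by positivity, fun x hx u => ?_⟩
    have e₁ := h₁ (f x) hx.2 u
    have e₂ := h₂ x hx.1
    have i₁ := S'.norm_coord_mono (show k + r + r' ≤ k + (r + r') by omega) x
    have i₂ := S₁.norm_coord_mono (show r ≤ r + r' by omega) u
    have i₃ := S₁.norm_coord_mono (show k + r ≤ k + (r + r') by omega) u
    set X := ‖S'.coord (k + (r + r')) x‖
    set P := ‖S₁.coord (r + r') u‖
    set Q := ‖S₁.coord (k + (r + r')) u‖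
    have hX : 0 ≤ X := norm_nonneg _
    have hP : 0 ≤ P := norm_nonneg _
    have hQ : 0 ≤ Q := norm_nonneg _
    calc ‖S₂.coord k (φ (f x) u)‖ ≤ C₁ * ((1 + C₂ * (1 + X)) * P + Q) := by
          refine e₁.trans ?_
          gcongr
          refine e₂.trans ?_
          gcongr
      _ ≤ C₁ * (1 + C₂) * ((1 + X) * P + Q) := by
          have : 0 ≤ C₁ * X * P + C₁ * C₂ * Q := by positivity
          linarith

theorem IsLocalSmoothing.isLocalFamily (hκ : IsLocalSmoothing c S S₁ S₂ x₀ κ) :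
    IsLocalFamily c S S₁ S₂ x₀ κ := by
  constructor
  · obtain ⟨V, hV, m, n, hm, h⟩ := hκ.1
    refine ⟨V, hV, _, hm.add n, fun k => ?_⟩
    exact (h k).mono (by omega) (by omega) le_rfl
  · intro hc
    obtain ⟨V, hV, r, h⟩ := hκ.2 hc
    refine ⟨V, hV, r, fun k => ?_⟩
    obtain ⟨C, hC, h⟩ := h k
    refine ⟨C, hC, fun x hx u => (h x hx u).trans ?_⟩
    gcongr
    exact le_add_of_nonneg_right (norm_nonneg _)

/-- The loss of levels in `ψ` is absorbed on the target side of `κ`, so its source level `n`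
survives. -/
theorem IsLocalFamily.comp_smoothing (hψ : IsLocalFamily c S S₂ S₃ x₀ ψ)
    (hκ : IsLocalSmoothing c S S₁ S₂ x₀ κ) :
    IsLocalSmoothing c S S₁ S₃ x₀ (fun x => (ψ x).comp (κ x)) := by
  constructor
  · obtain ⟨V, hV, m, n, hm, h⟩ := hκ.1
    obtain ⟨V', hV', m', hm', h'⟩ := hψ.1
    refine ⟨V ∩ V', Filter.inter_mem hV hV', _, n, hm.comp hm', fun k => ?_⟩
    exact ((h' k).mono hm.1.le_apply le_rfl le_rfl).comp (h (m' k))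
  · intro hc
    obtain ⟨V, hV, r, h⟩ := hκ.2 hc
    obtain ⟨V', hV', r', h'⟩ := hψ.2 hc
    obtain ⟨V'', hV'', B, hB, hB'⟩ := S.exists_mem_nhds_norm_le x₀ (r' + r)
    refine ⟨V ∩ V' ∩ V'', Filter.inter_mem (Filter.inter_mem hV hV') hV'', r' + r, fun k => ?_⟩
    obtain ⟨C₀, hC₀, h₀⟩ := h r'
    obtain ⟨C₁, hC₁, h₁⟩ := h (k + r')
    obtain ⟨C₂, hC₂, h₂⟩ := h' k
    refine ⟨C₂ * (C₀ * (1 + B) + C₁), by positivity, fun x hx u => ?_⟩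
    have e₀ := h₀ x hx.1.1 u
    have e₁ := h₁ x hx.1.1 u
    have e₂ := h₂ x hx.1.2 (κ x u)
    have i₀ := hB' x hx.2 (r' + r) le_rfl
    have i₁ := S.norm_coord_mono (show k + r' ≤ k + (r' + r) by omega) x
    have i₂ := S.norm_coord_mono (show k + r' + r ≤ k + (r' + r) by omega) x
    have i₃ := S₁.norm_coord_mono (show r ≤ r' + r by omega) u
    set X := ‖S.coord (k + (r' + r)) x‖
    set P := ‖S₁.coord (r' + r) u‖
    have hX : 0 ≤ X := norm_nonneg _
    have hP : 0 ≤ P := norm_nonneg _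
    calc ‖S₃.coord k (ψ x (κ x u))‖
        ≤ C₂ * ((1 + X) * (C₀ * ((1 + B) * P)) + C₁ * ((1 + X) * P)) := by
          refine e₂.trans ?_
          gcongr
          · refine e₀.trans ?_
            gcongr
          · refine e₁.trans ?_
            gcongr
      _ = C₂ * (C₀ * (1 + B) + C₁) * ((1 + X) * P) := by ring

/-- Of `φ` only the extension into the one level `n` from which `μ` starts is needed; its source
level `m n` does not depend on `k`. -/
theorem IsLocalSmoothing.comp_family (hμ : IsLocalSmoothing c S S₂ S₃ x₀ μ)
    (hφ : IsLocalFamily c S S₁ S₂ x₀ φ) :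
    IsLocalSmoothing c S S₁ S₃ x₀ (fun x => (μ x).comp (φ x)) := by
  constructor
  · obtain ⟨V, hV, m, hm, h⟩ := hφ.1
    obtain ⟨V', hV', m', n, hm', h'⟩ := hμ.1
    refine ⟨V ∩ V', Filter.inter_mem hV hV', _, m n, hm'.add (m n), fun k => ?_⟩
    exact ((h' k).mono (by omega) le_rfl le_rfl).comp ((h n).mono (by omega) le_rfl le_rfl)
  · intro hc
    obtain ⟨V, hV, r, h⟩ := hφ.2 hc
    obtain ⟨V', hV', r', h'⟩ := hμ.2 hc
    obtain ⟨V'', hV'', B, hB, hB'⟩ := S.exists_mem_nhds_norm_le x₀ (r' + r)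
    refine ⟨V ∩ V' ∩ V'', Filter.inter_mem (Filter.inter_mem hV hV') hV'', r' + r, fun k => ?_⟩
    obtain ⟨C₀, hC₀, h₀⟩ := h r'
    obtain ⟨C₂, hC₂, h₂⟩ := h' k
    refine ⟨C₂ * (C₀ * (2 + B)), by positivity, fun x hx u => ?_⟩
    have e₀ := h₀ x hx.1.1 u
    have e₂ := h₂ x hx.1.2 (φ x u)
    have i₀ := hB' x hx.2 (r' + r) le_rfl
    have i₁ := S.norm_coord_mono (show k + r' ≤ k + (r' + r) by omega) x
    have i₃ := S₁.norm_coord_mono (show r ≤ r' + r by omega) u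
    set X := ‖S.coord (k + (r' + r)) x‖
    set P := ‖S₁.coord (r' + r) u‖
    have hX : 0 ≤ X := norm_nonneg _
    have hP : 0 ≤ P := norm_nonneg _
    calc ‖S₃.coord k (μ x (φ x u))‖
        ≤ C₂ * ((1 + X) * (C₀ * ((1 + B) * P + P))) := by
          refine e₂.trans ?_
          gcongr
          refine e₀.trans ?_
          gcongr
      _ = C₂ * (C₀ * (2 + B)) * ((1 + X) * P) := by ring

theorem IsLocalSmoothing.add (hκ : IsLocalSmoothing c S S₁ S₂ x₀ κ)
    (hκ' : IsLocalSmoothing c S S₁ S₂ x₀ κ') :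
    IsLocalSmoothing c S S₁ S₂ x₀ (fun x => κ x + κ' x) := by
  constructor
  · obtain ⟨V, hV, m, n, hm, h⟩ := hκ.1
    obtain ⟨V', hV', m', n', hm', h'⟩ := hκ'.1
    refine ⟨V ∩ V', Filter.inter_mem hV hV', _, max n n', hm.max hm', fun k => ?_⟩
    exact ((h k).mono (le_max_left _ _) (le_max_left _ _) le_rfl).add
      ((h' k).mono (le_max_right _ _) (le_max_right _ _) le_rfl)
  · intro hc
    obtain ⟨V, hV, r, h⟩ := hκ.2 hc
    obtain ⟨V', hV', r', h'⟩ := hκ'.2 hc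
    refine ⟨V ∩ V', Filter.inter_mem hV hV', max r r', fun k => ?_⟩
    obtain ⟨C₁, hC₁, h₁⟩ := h k
    obtain ⟨C₂, hC₂, h₂⟩ := h' k
    refine ⟨C₁ + C₂, by positivity, fun x hx u => ?_⟩
    rw [LinearMap.add_apply, map_add, add_mul]
    refine (norm_add_le _ _).trans (add_le_add ((h₁ x hx.1 u).trans ?_) ((h₂ x hx.2 u).trans ?_))
    · have := S.norm_coord_mono (show k + r ≤ k + max r r' by omega) x
      have := S₁.norm_coord_mono (show r ≤ max r r' by omega) u
      gcongr
    · have := S.norm_coord_mono (show k + r' ≤ k + max r r' by omega) x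
      have := S₁.norm_coord_mono (show r' ≤ max r r' by omega) u
      gcongr

theorem IsLocalSmoothing.pullback {x₀ : E'} {f : E' → E} (hf : IsLocalMap c S' S x₀ f)
    (hκ : IsLocalSmoothing c S S₁ S₂ (f x₀) κ) :
    IsLocalSmoothing c S' S₁ S₂ x₀ (fun x => κ (f x)) := by
  constructor
  · obtain ⟨V, hV, m, n, hm, h⟩ := hκ.1
    obtain ⟨V', hV', m', hm', h'⟩ := hf.1
    refine ⟨V' ∩ f ⁻¹' V, Filter.inter_mem hV' (hf.continuousAt hV), _, n, hm'.comp hm,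
      fun k => ?_⟩
    exact (h k).pullback (h' (m k))
  · intro hc
    obtain ⟨V, hV, r, h⟩ := hκ.2 hc
    obtain ⟨V', hV', r', h'⟩ := hf.2 hc
    refine ⟨V' ∩ f ⁻¹' V, Filter.inter_mem hV' (hf.continuousAt hV), r + r', fun k => ?_⟩
    obtain ⟨C₁, hC₁, h₁⟩ := h k
    obtain ⟨C₂, hC₂, h₂⟩ := h' (k + r)
    refine ⟨C₁ * (1 + C₂), by positivity, fun x hx u => ?_⟩
    have e₁ := h₁ (f x) hx.2 u
    have e₂ := h₂ x hx.1
    have i₁ := S'.norm_coord_mono (show k + r + r' ≤ k + (r + r') by omega) x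
    have i₂ := S₁.norm_coord_mono (show r ≤ r + r' by omega) u
    set X := ‖S'.coord (k + (r + r')) x‖
    set P := ‖S₁.coord (r + r') u‖
    have hX : 0 ≤ X := norm_nonneg _
    have hP : 0 ≤ P := norm_nonneg _
    calc ‖S₂.coord k (κ (f x) u)‖ ≤ C₁ * ((1 + C₂ * (1 + X)) * P) := by
          refine e₁.trans ?_
          gcongr
          refine e₂.trans ?_
          gcongr
      _ ≤ C₁ * (1 + C₂) * ((1 + X) * P) := by
          have : 0 ≤ C₁ * X * P := by positivity
          linarith

end LocalFamilies

/-! ### From envelopes in arbitrary compatible structures to local data in the fixed ones. -/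

section Extraction

/-- Homogeneity: scale `u` into the region where the affine bound holds. The constant term then
becomes a multiple of `‖a u‖`, which gives tame estimates for linear families their form. -/
theorem norm_le_of_forall_norm_lt {𝕜 : Type*} [RCLike 𝕜] {D X Y Z : Type*} [AddCommGroup D]
    [Module 𝕜 D] [NormedAddCommGroup X] [NormedSpace 𝕜 X] [NormedAddCommGroup Y] [NormedSpace 𝕜 Y]
    [NormedAddCommGroup Z] [NormedSpace 𝕜 Z] (a : D →ₗ[𝕜] X) (b : D →ₗ[𝕜] Y) (d : D →ₗ[𝕜] Z)
    {ρ M N : ℝ} (hρ : 0 < ρ) (hM : 0 ≤ M)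
    (h : ∀ u, ‖a u‖ < ρ → ‖b u‖ ≤ M + N * ‖d u‖) (u : D) :
    ‖b u‖ ≤ M * (‖a u‖ / ρ) + N * ‖d u‖ := by
  refine le_of_forall_pos_le_add fun ε hε => ?_
  -- The second summand keeps `s` positive even if `a u = 0`, makes the scaled vector strictly
  -- smaller than `ρ`, and contributes at most `ε` after multiplication by `M`.
  set s : ℝ := ‖a u‖ / ρ + ε / (M + 1) with hs
  have hs0 : 0 < s := by positivity
  have hsa : ‖a u‖ < s * ρ := by
    rw [← div_lt_iff₀ hρ, hs]
    exact lt_add_of_pos_right _ (by positivity)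
  have hn : ‖((s : 𝕜)⁻¹)‖ = s⁻¹ := by
    rw [norm_inv, RCLike.norm_ofReal, abs_of_pos hs0]
  have h1 := h ((s : 𝕜)⁻¹ • u) (by
    rw [map_smul, norm_smul, hn, inv_mul_lt_iff₀ hs0]
    exact hsa)
  rw [map_smul, map_smul, norm_smul, norm_smul, hn, inv_mul_le_iff₀ hs0] at h1
  have h2 : s * (M + N * (s⁻¹ * ‖d u‖)) = M * s + N * ‖d u‖ := by
    field_simp
  have h3 : M * (ε / (M + 1)) ≤ ε := by
    rw [mul_div_assoc', div_le_iff₀ (by positivity)]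
    nlinarith
  rw [h2, hs] at h1
  linarith

theorem ScContext.admissible_add_left (c : ScContext) (q : ℕ) : c.Admissible (fun j => q + j) := by
  simpa only [add_comm] using c.admissible_add q

variable {𝕜 : Type v} [RCLike 𝕜]
variable {E : Type u} [AddCommGroup E] [Module 𝕜 E] [TopologicalSpace E]
variable {E' : Type u'} [AddCommGroup E'] [Module 𝕜 E'] [TopologicalSpace E']
variable {E₁ : Type u₁} [AddCommGroup E₁] [Module 𝕜 E₁] [TopologicalSpace E₁]
variable {E₂ : Type u₂} [AddCommGroup E₂] [Module 𝕜 E₂] [TopologicalSpace E₂]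

variable (𝕜 E) in
/-- The representative of the class of compatible sc-structures. -/
noncomputable abbrev baseStructure [ScFrechetSpace 𝕜 E] : ScStructure 𝕜 E := ScFrechetSpace.base

/-- The envelope is conjugated by the bounded operators that extend the identity from the base
structure to `T` and from `T'` back to the base structure. -/
theorem IsScContinuousOn.isLocalMap [ScFrechetSpace 𝕜 E] [ScFrechetSpace 𝕜 E'] {c : ScContext}
    {U : Set E} {f : E → E'} (hf : IsScContinuousOn 𝕜 c U f) {x₀ : E} (hx₀ : x₀ ∈ U) :
    IsLocalMap c (baseStructure 𝕜 E) (baseStructure 𝕜 E') x₀ f := by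
  obtain ⟨V, hV, -, T, T', W, F, hT, hT', hF, htame⟩ := hf x₀ hx₀
  obtain ⟨m, hm, hJ⟩ := hT.1.exists_clm
  obtain ⟨m', hm', hJ'⟩ := hT'.2.exists_clm
  have hVW : ∀ x ∈ V, ∀ i, T.coord i x ∈ W i := fun x hx i => by
    rw [hF.eq_iInter] at hx
    exact mem_iInter.1 hx i
  constructor
  · obtain ⟨p, r, hr, hball⟩ := (baseStructure 𝕜 E).exists_ball_subset hV
    refine ⟨_, (baseStructure 𝕜 E).ball_mem_nhds x₀ p hr, _, (hm.comp hm').add p, fun k => ?_⟩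
    obtain ⟨J, hJ⟩ := hJ (m' k)
    obtain ⟨J', hJ'⟩ := hJ' k
    have h₁ : m (m' k) ≤ m (m' k) + p := by omega
    have h₂ : p ≤ m (m' k) + p := by omega
    set I := (baseStructure 𝕜 E).chain.incl h₁
    set I' := (baseStructure 𝕜 E).chain.incl h₂
    refine ⟨(fun x => J (I x)) ⁻¹' W (m' k) ∩ {x | ‖I' x - (baseStructure 𝕜 E).coord p x₀‖ < r},
      fun x => J' (F (m' k) (J (I x))), ?_, fun x => ?_, ?_, fun x hx => ?_⟩
    · exact ((hF.isOpen _).preimage (J.continuous.comp I.continuous)).inter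
        (isOpen_lt ((I'.continuous.sub continuous_const).norm) continuous_const)
    · rw [mem_inter_iff, mem_preimage, mem_ofPred_eq, ScStructure.incl_coord,
        ScStructure.incl_coord, hJ]
      exact ⟨fun hx => hx.2, fun hx => ⟨hVW x (hball hx) _, hx⟩⟩
    · exact J'.continuous.comp_continuousOn ((hF.continuousOn _).comp
        (J.continuous.comp I.continuous).continuousOn fun x hx => hx.1)
    · dsimp only
      rw [ScStructure.incl_coord, hJ, hF.extend _ x (hball hx), hJ']
  · intro hc
    obtain ⟨r, hr⟩ := (hm.comp hm').2 hc
    refine ⟨V, hV, r, fun k => ?_⟩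
    obtain ⟨J, hJ⟩ := hJ (m' k)
    obtain ⟨J', hJ'⟩ := hJ' k
    obtain ⟨C, hC⟩ := htame hc (m' k)
    refine ⟨‖J'‖ * (|C| * (1 + ‖J‖)), by positivity, fun x hx => ?_⟩
    have h₁ := hC _ (hVW x hx _)
    rw [hF.extend _ x hx, ← hJ] at h₁
    have h₂ := J.le_opNorm ((baseStructure 𝕜 E).coord _ x)
    have h₃ := (baseStructure 𝕜 E).norm_coord_mono (hr k) x
    set X := ‖(baseStructure 𝕜 E).coord (k + r) x‖
    have hX : 0 ≤ X := norm_nonneg _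
    rw [← hJ']
    calc _ ≤ ‖J'‖ * (|C| * (1 + ‖J‖ * X)) := by
          refine (J'.le_opNorm _).trans ?_
          gcongr
          refine h₁.trans ?_
          gcongr
          · exact le_abs_self C
          · exact h₂.trans (by gcongr)
      _ ≤ ‖J'‖ * (|C| * (1 + ‖J‖)) * (1 + X) := by
          have : 0 ≤ ‖J'‖ * |C| * (‖J‖ + X) := by positivity
          linarith

/-- By linearity, information near the zero vector determines the family on all vectors: homogeneity
extends both the operators and the estimates. -/
theorem IsLocalMap.isLocalFamily {c : ScContext} {S : ScStructure 𝕜 E} {S₁ : ScStructure 𝕜 E₁}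
    {S₂ : ScStructure 𝕜 E₂} {x₀ : E} {φ : E → E₁ →ₗ[𝕜] E₂}
    (h : IsLocalMap c (S.prod S₁) S₂ (x₀, 0) (fun p : E × E₁ => φ p.1 p.2)) :
    IsLocalFamily c S S₁ S₂ x₀ φ := by
  have hball : ∀ {p : ℕ} {r : ℝ} {x : E} {u : E₁},
      (x, u) ∈ (S.prod S₁).ball (x₀, 0) p r ↔ x ∈ S.ball x₀ p r ∧ ‖S₁.coord p u‖ < r := by
    intro p r x u
    change ‖(S.coord p x - S.coord p x₀, S₁.coord p u - S₁.coord p 0)‖ < r ↔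
      ‖S.coord p x - S.coord p x₀‖ < r ∧ ‖S₁.coord p u‖ < r
    rw [map_zero, sub_zero, Prod.norm_mk, max_lt_iff]
  constructor
  · obtain ⟨V, hV, m, hm, h⟩ := h.1
    obtain ⟨p, r, hr, hpr⟩ := (S.prod S₁).exists_ball_subset hV
    -- The shift by `p` makes the ball visible at the level in question; the extra one pays for the
    -- compact inclusion that yields norm continuity.
    refine ⟨_, S.ball_mem_nhds x₀ p hr, _, hm.add (p + 1), fun k => ?_⟩
    obtain ⟨W, F, hW, hWV, hF, hf⟩ := h k
    have h₁ : m k ≤ m k + p := by omega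
    have h₂ : p ≤ m k + p := by omega
    set I := (S.prod S₁).chain.incl h₁ with hI
    have hIc : ∀ x u, I (S.coord _ x, S₁.coord _ u) = (S.prod S₁).coord (m k) (x, u) :=
      fun x u => (S.prod S₁).incl_coord h₁ (x, u)
    let O : Set (S.chain.X (m k + p) × S₁.chain.X (m k + p)) := I ⁻¹' W ∩
      {q | ‖S.chain.incl h₂ q.1 - S.coord p x₀‖ < r ∧ ‖S₁.chain.incl h₂ q.2‖ < r}
    have hO : IsOpen O := by
      refine (hW.preimage I.continuous).inter (IsOpen.and
        (isOpen_lt ?_ continuous_const) (isOpen_lt ?_ continuous_const))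
      · exact (((S.chain.incl h₂).continuous.comp continuous_fst).sub continuous_const).norm
      · exact ((S₁.chain.incl h₂).continuous.comp continuous_snd).norm
    have hOmem : ∀ x u, (S.coord _ x, S₁.coord _ u) ∈ O ↔
        x ∈ S.ball x₀ p r ∧ ‖S₁.coord p u‖ < r := by
      intro x u
      rw [mem_inter_iff, mem_preimage, hIc, hWV, mem_ofPred_eq, S.incl_coord, S₁.incl_coord]
      exact ⟨fun hx => hx.2, fun hx => ⟨hpr (hball.2 hx), hx⟩⟩
    obtain ⟨Φ, hΦ, hφ⟩ := exists_continuousOn_linear_extension (S.denseRange_coord _)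
      (i₁ := (S₁.coord (m k + p)).toLinearMap) (S₁.denseRange_coord _) hO
      (F := fun q => F (I q)) (hF.comp I.continuous.continuousOn fun q hq => hq.1)
      (fun x => (S₂.coord k).toLinearMap.comp (φ x))
      (fun x u hxu => by
        have := hf (x, u) (hpr (hball.2 ((hOmem x u).1 hxu)))
        rw [← hIc] at this
        exact this)
      (S₁.chain.ι_compact (m k + p))
    have hWO : ∀ x, S.coord (m k + p) x ∈ {y | (y, (0 : S₁.chain.X (m k + p))) ∈ O} ↔
        x ∈ S.ball x₀ p r := by
      intro x
      have := hOmem x 0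
      rw [map_zero] at this
      rw [mem_ofPred_eq, this]
      exact and_iff_left (by simpa using hr)
    have hlev : ExtendsToLevels S S₁ S₂ (S.ball x₀ p r) φ (m k + p) (m k + p + 1) k := by
      refine ⟨_, Φ, hO.preimage (by fun_prop), hWO, hΦ, fun x hx u => ?_⟩
      exact hφ x ((hWO x).2 hx) _ u (S₁.ι_coord _ u)
    exact hlev.mono (by omega) (by omega) le_rfl
  · intro hc
    obtain ⟨V, hV, s, h⟩ := h.2 hc
    obtain ⟨p, r, hr, hpr⟩ := (S.prod S₁).exists_ball_subset hV
    refine ⟨_, S.ball_mem_nhds x₀ p hr, p + s, fun k => ?_⟩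
    obtain ⟨C, hC, h⟩ := h k
    refine ⟨C / r + C, by positivity, fun x hx u => ?_⟩
    have h₁ := norm_le_of_forall_norm_lt (S₁.coord p).toLinearMap
      ((S₂.coord k).toLinearMap.comp (φ x)) (S₁.coord (k + s)).toLinearMap hr
      (M := C * (1 + ‖S.coord (k + s) x‖)) (N := C) (by positivity) (fun u hu => ?_) u
    · have i₁ := S.norm_coord_mono (show k + s ≤ k + (p + s) by omega) x
      have i₂ := S₁.norm_coord_mono (show p ≤ p + s by omega) u
      have i₃ := S₁.norm_coord_mono (show k + s ≤ k + (p + s) by omega) u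
      simp only [LinearMap.comp_apply, ContinuousLinearMap.coe_coe] at h₁
      set X := ‖S.coord (k + (p + s)) x‖
      set P := ‖S₁.coord (p + s) u‖
      set Q := ‖S₁.coord (k + (p + s)) u‖
      have hX : 0 ≤ X := norm_nonneg _
      have hP : 0 ≤ P := norm_nonneg _
      have hQ : 0 ≤ Q := norm_nonneg _
      calc _ ≤ C * (1 + X) * (P / r) + C * Q := h₁.trans (by gcongr)
        _ ≤ (C / r + C) * ((1 + X) * P + Q) := by
          have : 0 ≤ C / r * Q + C * ((1 + X) * P) := by positivity
          have e : C * (1 + X) * (P / r) = C / r * ((1 + X) * P) := by ring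
          rw [e]
          linarith
    · refine (h (x, u) (hpr (hball.2 ⟨hx, hu⟩))).trans ?_
      have : ‖(S.prod S₁).coord (k + s) (x, u)‖ ≤ ‖S.coord (k + s) x‖ + ‖S₁.coord (k + s) u‖ :=
        max_le (le_add_of_nonneg_right (norm_nonneg _)) (le_add_of_nonneg_left (norm_nonneg _))
      calc _ ≤ C * (1 + (‖S.coord (k + s) x‖ + ‖S₁.coord (k + s) u‖)) := by gcongr
        _ = _ := by simp only [ContinuousLinearMap.coe_coe]; ring

variable [ScFrechetSpace 𝕜 E] [ScFrechetSpace 𝕜 E₁] [ScFrechetSpace 𝕜 E₂]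

theorem IsFamily.isLocalFamily {c : ScContext} {U : Set E} {φ : E → E₁ →ₗ[𝕜] E₂}
    (h : IsFamily c U φ) {x₀ : E} (hx₀ : x₀ ∈ U) :
    IsLocalFamily c (baseStructure 𝕜 E) (baseStructure 𝕜 E₁) (baseStructure 𝕜 E₂) x₀ φ :=
  IsLocalMap.isLocalFamily (IsScContinuousOn.isLocalMap h (x₀ := (x₀, 0)) ⟨hx₀, mem_univ _⟩)

/-- The lifting property for the sequence `j ↦ i + j`, read at `j = 0`, gives a map from source
level zero to target level `i`. Doing this for every `i` shows that one source level reaches all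
targets. -/
theorem HasStronglySmoothingEnvelope.isLocalSmoothing {c : ScContext} {V : Set E}
    {κ : E → E₁ →ₗ[𝕜] E₂} (h : HasStronglySmoothingEnvelope c V κ) {x₀ : E} (hV : V ∈ 𝓝 x₀) :
    IsLocalSmoothing c (baseStructure 𝕜 E) (baseStructure 𝕜 E₁) (baseStructure 𝕜 E₂) x₀ κ := by
  obtain ⟨T, T₁, T₂, W, K₀, hT, hT₁, hT₂, -, -, hK⟩ := h
  obtain ⟨m, hm, hJ⟩ := hT.1.exists_clm
  obtain ⟨m₁, hm₁, hJ₁⟩ := hT₁.1.exists_clm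
  obtain ⟨m₂, hm₂, hJ₂⟩ := hT₂.2.exists_clm
  obtain ⟨J₁, hJ₁⟩ := hJ₁ 0
  have hlift : ∀ i, ∃ K : T.chain.X i × T₁.chain.X 0 → T₂.chain.X i, IsOpen (W i) ∧
      (∀ x ∈ V, T.coord i x ∈ W i) ∧ ContinuousOn K (W i ×ˢ univ) ∧
      (∀ x ∈ V, ∀ u, K (T.coord i x, T₁.coord 0 u) = T₂.coord i (κ x u)) ∧
      (c = ScContext.tame → TameEstimateOn K
        (W i ×ˢ {u : T₁.chain.X 0 | ‖T₁.chain.incl (Nat.zero_le 0) u‖ < 1})) := by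
    intro i
    obtain ⟨K, hK, hKtame, -⟩ := hK _ (c.admissible_add_left i)
    have h₁ : IsOpen ((fun x => (x, (0 : T₁.chain.X 0))) ⁻¹'
        (W i ×ˢ (univ : Set (T₁.chain.X 0)))) :=
      (hK.isOpen 0).preimage (by fun_prop)
    refine ⟨K 0, by simpa using h₁, fun x hx => ?_, hK.continuousOn 0,
      fun x hx u => hK.extend 0 (x, u) ⟨hx, mem_univ _⟩, fun hc => hKtame hc 0⟩
    have h₂ : (x, (0 : E₁)) ∈ V ×ˢ (univ : Set E₁) := ⟨hx, mem_univ _⟩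
    rw [hK.eq_iInter] at h₂
    exact (mem_iInter.1 h₂ 0).1
  choose K hWo hVW hKc hKκ hKt using hlift
  constructor
  · obtain ⟨p, r, hr, hball⟩ := (baseStructure 𝕜 E).exists_ball_subset hV
    -- Level `m₁ 0` of the base structure maps to level zero of `T₁`; one more level provides the
    -- compact inclusion.
    refine ⟨_, (baseStructure 𝕜 E).ball_mem_nhds x₀ p hr, _, m₁ 0 + 1, (hm.comp hm₂).add p,
      fun k => ?_⟩
    obtain ⟨J, hJ⟩ := hJ (m₂ k)
    obtain ⟨J₂, hJ₂⟩ := hJ₂ k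
    have h₁ : m (m₂ k) ≤ m (m₂ k) + p := by omega
    have h₂ : p ≤ m (m₂ k) + p := by omega
    set I := (baseStructure 𝕜 E).chain.incl h₁
    set I' := (baseStructure 𝕜 E).chain.incl h₂
    let W' := (fun x => J (I x)) ⁻¹' W (m₂ k) ∩
      {x | ‖I' x - (baseStructure 𝕜 E).coord p x₀‖ < r}
    have hW' : IsOpen W' := ((hWo _).preimage (J.continuous.comp I.continuous)).inter
        (isOpen_lt ((I'.continuous.sub continuous_const).norm) continuous_const)
    have hmem : ∀ x, (baseStructure 𝕜 E).coord _ x ∈ W' ↔ x ∈ (baseStructure 𝕜 E).ball x₀ p r := by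
      intro x
      rw [mem_inter_iff, mem_preimage, mem_ofPred_eq, ScStructure.incl_coord,
        ScStructure.incl_coord, hJ]
      exact ⟨fun hx => hx.2, fun hx => ⟨hVW _ x (hball hx), hx⟩⟩
    obtain ⟨Φ, hΦ, hφ⟩ := exists_continuousOn_linear_extension
      ((baseStructure 𝕜 E).denseRange_coord _)
      (i₁ := ((baseStructure 𝕜 E₁).coord (m₁ 0)).toLinearMap)
      ((baseStructure 𝕜 E₁).denseRange_coord _) (hW'.prod isOpen_univ)
      (F := fun q => J₂ (K (m₂ k) (J (I q.1), J₁ q.2)))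
      (J₂.continuous.comp_continuousOn ((hKc _).comp
        (((J.continuous.comp I.continuous).comp continuous_fst).prodMk
          (J₁.continuous.comp continuous_snd)).continuousOn fun q hq => ⟨hq.1.1, mem_univ _⟩))
      (fun x => ((baseStructure 𝕜 E₂).coord k).toLinearMap.comp (κ x))
      (fun x u hxu => by
        simp only [ContinuousLinearMap.coe_coe, LinearMap.comp_apply]
        rw [ScStructure.incl_coord, hJ, hJ₁, hKκ _ x (hball ((hmem x).1 hxu.1)), hJ₂])
      ((baseStructure 𝕜 E₁).chain.ι_compact (m₁ 0))
    refine ⟨W', Φ, hW', hmem, hΦ.mono fun x hx => ⟨hx, mem_univ _⟩, fun x hx u => ?_⟩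
    exact hφ x ⟨(hmem x).2 hx, mem_univ _⟩ _ u (ScStructure.ι_coord _ _ u)
  · intro hc
    obtain ⟨r, hr⟩ := (hm.comp hm₂).2 hc
    refine ⟨V, hV, max r (m₁ 0), fun k => ?_⟩
    obtain ⟨J, hJ⟩ := hJ (m₂ k)
    obtain ⟨J₂, hJ₂⟩ := hJ₂ k
    obtain ⟨C, hC⟩ := hKt (m₂ k) hc
    refine ⟨‖J₂‖ * (|C| * (2 + ‖J‖) * ‖J₁‖), by positivity, fun x hx u => ?_⟩
    -- On the unit ball of level zero the norm of `(x, u)` is at most `1 + ‖x‖`, whence the bound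
    -- `|C| * (2 + ‖x‖)`. It has no further term in `u`, so `N = 0`.
    have h₁ := norm_le_of_forall_norm_lt (T₁.coord 0).toLinearMap
      ((T₂.coord (m₂ k)).toLinearMap.comp (κ x)) (T₁.coord 0).toLinearMap one_pos
      (M := |C| * (2 + ‖T.coord (m₂ k) x‖)) (N := 0) (by positivity) (fun u hu => ?_) u
    · simp only [LinearMap.comp_apply, ContinuousLinearMap.coe_coe, zero_mul, add_zero,
        div_one] at h₁
      have e₁ := J.le_opNorm ((baseStructure 𝕜 E).coord _ x)
      have e₂ := J₁.le_opNorm ((baseStructure 𝕜 E₁).coord _ u)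
      rw [hJ] at e₁
      rw [hJ₁] at e₂
      have i₁ := (baseStructure 𝕜 E).norm_coord_mono
        ((hr k).trans (show k + r ≤ k + max r (m₁ 0) by omega)) x
      have i₂ := (baseStructure 𝕜 E₁).norm_coord_mono (le_max_right r (m₁ 0)) u
      set X := ‖(baseStructure 𝕜 E).coord (k + max r (m₁ 0)) x‖
      set P := ‖(baseStructure 𝕜 E₁).coord (max r (m₁ 0)) u‖
      have hX : 0 ≤ X := norm_nonneg _
      have hP : 0 ≤ P := norm_nonneg _
      rw [← hJ₂]
      calc _ ≤ ‖J₂‖ * (|C| * (2 + ‖J‖ * X) * (‖J₁‖ * P)) := by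
            refine (J₂.le_opNorm _).trans ?_
            gcongr
            refine h₁.trans ?_
            gcongr
            · exact e₁.trans (by gcongr)
            · exact e₂.trans (by gcongr)
        _ ≤ ‖J₂‖ * (|C| * (2 + ‖J‖) * ‖J₁‖) * ((1 + X) * P) := by
            have : 0 ≤ ‖J₂‖ * |C| * (‖J₁‖ * P) * (2 * X + ‖J‖) := by positivity
            linarith
    · have hu' : ‖T₁.coord 0 u‖ < 1 := hu
      have h₂ := hC (T.coord (m₂ k) x, T₁.coord 0 u) ⟨hVW _ x hx, by
        change ‖T₁.chain.incl (Nat.zero_le 0) (T₁.coord 0 u)‖ < 1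
        rwa [T₁.incl_coord]⟩
      rw [hKκ _ x hx] at h₂
      rw [zero_mul, add_zero]
      have h₃ : ‖(T.coord (m₂ k) x, T₁.coord 0 u)‖ ≤ 1 + ‖T.coord (m₂ k) x‖ :=
        max_le (le_add_of_nonneg_left zero_le_one)
          (hu'.le.trans (le_add_of_nonneg_right (norm_nonneg _)))
      calc _ ≤ C * (1 + ‖(T.coord (m₂ k) x, T₁.coord 0 u)‖) := h₂
        _ ≤ |C| * (1 + (1 + ‖T.coord (m₂ k) x‖)) := by
          gcongr
          exact le_abs_self C
        _ = _ := by ring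

theorem IsStronglySmoothing.isLocalSmoothing {c : ScContext} {U : Set E} {κ : E → E₁ →ₗ[𝕜] E₂}
    (h : IsStronglySmoothing c U κ) {x₀ : E} (hx₀ : x₀ ∈ U) :
    IsLocalSmoothing c (baseStructure 𝕜 E) (baseStructure 𝕜 E₁) (baseStructure 𝕜 E₂) x₀ κ := by
  obtain ⟨V, hV, -, hκ⟩ := h.2 x₀ hx₀
  exact hκ.isLocalSmoothing hV

end Extraction

/-! ### From local data back to envelopes. -/

section Construction

/-- Apply the density principle for equalities to `max f g = g`. This carries tame estimates from
`E` to the levels. -/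
theorem Dense.le_of_isOpen {X : Type*} [TopologicalSpace X]
    {s G : Set X} {f g : X → ℝ} (hs : Dense s) (hG : IsOpen G) (hf : ContinuousOn f G)
    (hg : ContinuousOn g G) (h : ∀ x ∈ G, x ∈ s → f x ≤ g x) {x : X} (hx : x ∈ G) : f x ≤ g x :=
  max_eq_right_iff.1 (hs.eqOn_of_isOpen hG (hf.sup hg) hg
    (fun x hx hxs => max_eq_right (h x hx hxs)) hx)

variable {𝕜 : Type v} [RCLike 𝕜]
variable {E : Type u} [AddCommGroup E] [Module 𝕜 E] [TopologicalSpace E]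
variable {E₁ : Type u₁} [AddCommGroup E₁] [Module 𝕜 E₁] [TopologicalSpace E₁]
variable {E₂ : Type u₂} [AddCommGroup E₂] [Module 𝕜 E₂] [TopologicalSpace E₂]

/-- Extensions of a family to all levels can be chosen on nested domains; they are then compatible
with the inclusions. -/
theorem exists_nested_extensions {S : ScStructure 𝕜 E} {S₁ : ScStructure 𝕜 E₁}
    {S₂ : ScStructure 𝕜 E₂} {V : Set E} {φ : E → E₁ →ₗ[𝕜] E₂} {m l : ℕ → ℕ} (hm : Monotone m)
    (hl : Monotone l) (h : ∀ k, ExtendsToLevels S S₁ S₂ V φ (m k) (l k) k) :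
    ∃ (W : ∀ k, Set (S.chain.X (m k)))
      (Φ : ∀ k, S.chain.X (m k) → S₁.chain.X (l k) →L[𝕜] S₂.chain.X k),
      (∀ k, IsOpen (W k)) ∧ (∀ i j (hij : i ≤ j), MapsTo (S.chain.incl (hm hij)) (W j) (W i)) ∧
      (∀ k x, S.coord (m k) x ∈ W k ↔ x ∈ V) ∧ (∀ k, ContinuousOn (Φ k) (W k)) ∧
      (∀ k, ∀ x ∈ V, ∀ u, Φ k (S.coord (m k) x) (S₁.coord (l k) u) = S₂.coord k (φ x u)) ∧
      ∀ i j (hij : i ≤ j), ∀ x ∈ W j, ∀ u,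
        Φ i (S.chain.incl (hm hij) x) (S₁.chain.incl (hl hij) u) =
          S₂.chain.incl hij (Φ j x u) := by
  choose W₀ Φ hW₀ hWV₀ hΦ₀ hφ using h
  -- Only finitely many lower levels impose conditions, so the set stays open; all of these
  -- conditions have the same trace `V` on `E`.
  let W : ∀ k, Set (S.chain.X (m k)) := fun k =>
    ⋂ i : Fin (k + 1), S.chain.incl (hm (Nat.lt_succ_iff.1 i.2)) ⁻¹' W₀ i
  have hWmem : ∀ k x, x ∈ W k ↔ ∀ i (hi : i ≤ k), S.chain.incl (hm hi) x ∈ W₀ i := fun k x =>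
    ⟨fun hx i hi => mem_iInter.1 hx ⟨i, Nat.lt_succ_iff.2 hi⟩,
      fun hx => mem_iInter.2 fun i => hx i (Nat.lt_succ_iff.1 i.2)⟩
  have hW : ∀ k, IsOpen (W k) := fun k =>
    isOpen_iInter_of_finite fun i => (hW₀ i).preimage (S.chain.incl _).continuous
  have hsub : ∀ k, W k ⊆ W₀ k := fun k x hx => by
    have := (hWmem k x).1 hx k le_rfl
    rwa [ScChain.incl_self] at this
  have hmaps : ∀ i j (hij : i ≤ j), MapsTo (S.chain.incl (hm hij)) (W j) (W i) := by
    intro i j hij x hx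
    refine (hWmem _ _).2 fun a ha => ?_
    rw [ScChain.incl_incl]
    exact (hWmem _ _).1 hx a (ha.trans hij)
  have hWV : ∀ k x, S.coord (m k) x ∈ W k ↔ x ∈ V := by
    refine fun k x => ⟨fun hx => (hWV₀ k x).1 (hsub k hx), fun hx => (hWmem _ _).2 fun i hi => ?_⟩
    rw [S.incl_coord, hWV₀]
    exact hx
  have hΦ : ∀ k, ContinuousOn (Φ k) (W k) := fun k => (hΦ₀ k).mono (hsub k)
  refine ⟨W, Φ, hW, hmaps, hWV, hΦ, hφ, fun i j hij x hx u => ?_⟩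
  refine ((S.denseRange_coord (m j)).prodMap (S₁.denseRange_coord (l j))).eqOn_of_isOpen
    (f := fun q => Φ i (S.chain.incl (hm hij) q.1) (S₁.chain.incl (hl hij) q.2))
    (g := fun q => S₂.chain.incl hij (Φ j q.1 q.2)) ((hW j).prod isOpen_univ)
    ?_ ?_ ?_ (x := (x, u)) ⟨hx, mem_univ _⟩
  · refine ContinuousOn.clm_apply ?_ (by fun_prop)
    exact (hΦ i).comp (f := fun q : S.chain.X (m j) × S₁.chain.X (l j) =>
      S.chain.incl (hm hij) q.1) (by fun_prop) fun q hq => hmaps i j hij hq.1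
  · refine (S₂.chain.incl hij).continuous.comp_continuousOn (ContinuousOn.clm_apply ?_ (by fun_prop))
    exact (hΦ j).comp continuous_fst.continuousOn fun q hq => hq.1
  · rintro _ ⟨hq, -⟩ ⟨⟨d, d₁⟩, rfl⟩
    have hd : d ∈ V := (hWV j d).1 hq
    simp only [Prod.map]
    rw [S.incl_coord, S₁.incl_coord, hφ i d hd, hφ j d hd, S₂.incl_coord]

variable [ScFrechetSpace 𝕜 E] [ScFrechetSpace 𝕜 E₁] [ScFrechetSpace 𝕜 E₂]

/-- The base structure of the product is rescaled by a sequence `M` that absorbs every loss of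
levels, so that `Φ k` starts at the `k`-th level of the rescaled chain. -/
theorem isFamily_of_isLocalFamily {c : ScContext} {U : Set E} (hU : IsOpen U)
    {φ : E → E₁ →ₗ[𝕜] E₂} (h : ∀ x ∈ U,
      IsLocalFamily c (baseStructure 𝕜 E) (baseStructure 𝕜 E₁) (baseStructure 𝕜 E₂) x φ) :
    IsFamily c U φ := by
  rintro ⟨x₀, u₀⟩ ⟨hx₀, -⟩
  set S := baseStructure 𝕜 E
  set S₁ := baseStructure 𝕜 E₁
  set S₂ := baseStructure 𝕜 E₂
  obtain ⟨⟨V₁, hV₁, m, hm, hext⟩, htame⟩ := h x₀ hx₀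
  obtain ⟨V₂, hV₂, r, htame⟩ : ∃ V ∈ 𝓝 x₀, ∃ r, c = ScContext.tame → ∀ k, ∃ C : ℝ, 0 ≤ C ∧
      ∀ x ∈ V, ∀ u, ‖S₂.coord k (φ x u)‖ ≤
        C * ((1 + ‖S.coord (k + r) x‖) * ‖S₁.coord r u‖ + ‖S₁.coord (k + r) u‖) := by
    by_cases hc : c = ScContext.tame
    · obtain ⟨V, hV, r, hr⟩ := htame hc
      exact ⟨V, hV, r, fun _ => hr⟩
    · exact ⟨univ, Filter.univ_mem, 0, fun hc' => absurd hc' hc⟩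
  obtain ⟨p, ρ, hρ, hball⟩ := S.exists_ball_subset
    (Filter.inter_mem (Filter.inter_mem hV₁ hV₂) (hU.mem_nhds hx₀))
  set V := S.ball x₀ p ρ
  obtain ⟨M, hM, hmM, hpM, hkM⟩ : ∃ M, c.Admissible M ∧ (∀ k, m k ≤ M k) ∧ (∀ k, p ≤ M k) ∧
      ∀ k, k + r ≤ M k :=
    ⟨_, hm.add (p + r), fun k => by omega, fun k => by omega, fun k => by
      have := hm.1.le_apply (x := k)
      omega⟩
  obtain ⟨W, Φ, hW, hmaps, hWV, hΦ, hφ, hcomm⟩ := exists_nested_extensions hM.1.monotone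
    hM.1.monotone fun k => ((hext k).mono (hmM k) (hmM k) le_rfl).restrict_ball
      (fun x hx => (hball hx).1.1) (hpM k)
  have hrM : ∀ k, r ≤ M k := fun k => (Nat.le_add_left r k).trans (hkM k)
  -- The product `(1 + ‖x‖) * ‖u‖_r` in the estimate is not affine in `(x, u)`. Bounding the level
  -- `r` norm of `u` near `u₀` makes it so.
  set R : ℝ := ‖S₁.coord r u₀‖ + 1
  let B : ∀ k, Set (S₁.chain.X (M k)) := fun k => {u | ‖S₁.chain.incl (hrM k) u‖ < R}
  have hB : ∀ k, IsOpen (B k) := fun k =>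
    isOpen_lt (S₁.chain.incl (hrM k)).continuous.norm continuous_const
  have hBmem : ∀ k u, S₁.coord (M k) u ∈ B k ↔ ‖S₁.coord r u‖ < R := fun k u => by
    rw [mem_ofPred_eq, S₁.incl_coord]
  have hcont : ∀ k, ContinuousOn (fun q : S.chain.X (M k) × S₁.chain.X (M k) => Φ k q.1 q.2)
      (W k ×ˢ univ) := fun k =>
    ((hΦ k).comp continuous_fst.continuousOn fun q hq => hq.1).clm_apply (by fun_prop)
  refine ⟨V ×ˢ {u | ‖S₁.coord r u‖ < R}, ?_, ?_, (S.prod S₁).rescale M hM.1, S₂,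
    fun k => W k ×ˢ B k, fun k q => Φ k q.1 q.2, ?_, ?_, ?_, ?_⟩
  · refine prod_mem_nhds (S.ball_mem_nhds x₀ p hρ) ?_
    refine (isOpen_lt (S₁.coord r).continuous.norm continuous_const).mem_nhds ?_
    change ‖S₁.coord r u₀‖ < ‖S₁.coord r u₀‖ + 1
    exact lt_add_one _
  · exact fun q hq => ⟨(hball hq.1).2, mem_univ _⟩
  · exact ScStructure.equivalent_rescale c (S.prod S₁) hM
  · exact ScStructure.equivalent_refl c S₂
  · have hι : ∀ k x u, ((S.prod S₁).rescale M hM.1).chain.ι k (x, u) =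
        (S.chain.incl (hM.1.monotone (Nat.le_succ k)) x,
          S₁.chain.incl (hM.1.monotone (Nat.le_succ k)) u) := fun k x u =>
      congrArg (fun T => T (x, u))
        (ScChain.prod_incl S.chain S₁.chain (hM.1.monotone (Nat.le_succ k)))
    refine ⟨fun k => (hW k).prod (hB k), ?_, ?_, ?_, ?_, ?_⟩
    · rintro k ⟨x, u⟩ ⟨hx, hu⟩
      rw [hι]
      refine ⟨hmaps _ _ (Nat.le_succ k) hx, ?_⟩
      change ‖S₁.chain.incl _ (S₁.chain.incl _ u)‖ < R
      rw [ScChain.incl_incl]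
      exact hu
    · ext ⟨x, u⟩
      rw [mem_iInter]
      constructor
      · exact fun hq k => ⟨(hWV k x).2 hq.1, (hBmem k u).2 hq.2⟩
      · exact fun hq => ⟨(hWV 0 x).1 (hq 0).1, (hBmem 0 u).1 (hq 0).2⟩
    · exact fun k => (hcont k).mono fun q hq => ⟨hq.1, mem_univ _⟩
    · rintro k ⟨x, u⟩ ⟨hx, -⟩
      exact hφ k x hx u
    · rintro k ⟨x, u⟩ ⟨hx, -⟩
      rw [hι]
      have := hcomm k (k + 1) (Nat.le_succ k) x hx u
      rwa [ScChain.incl_one] at this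
  · intro hc k
    obtain ⟨C, hC, hest⟩ := htame hc k
    have hest' : ∀ x ∈ W k, ∀ u, ‖Φ k x u‖ ≤
        C * ((1 + ‖x‖) * ‖S₁.chain.incl (hrM k) u‖ + ‖u‖) := by
      intro x hx u
      refine ((S.denseRange_coord (M k)).prodMap (S₁.denseRange_coord (M k))).le_of_isOpen
        (f := fun q => ‖Φ k q.1 q.2‖)
        (g := fun q => C * ((1 + ‖q.1‖) * ‖S₁.chain.incl (hrM k) q.2‖ + ‖q.2‖))
        ((hW k).prod isOpen_univ) (hcont k).norm (by fun_prop) ?_ (x := (x, u)) ⟨hx, mem_univ _⟩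
      rintro _ ⟨hq, -⟩ ⟨⟨d, d₁⟩, rfl⟩
      have hd : d ∈ V := (hWV k d).1 hq
      simp only [Prod.map]
      rw [hφ k d hd, S₁.incl_coord]
      refine (hest d (hball hd).1.2 d₁).trans ?_
      have := S.norm_coord_mono (hkM k) d
      have := S₁.norm_coord_mono (hkM k) d₁
      gcongr
    refine ⟨C * (R + 1), fun q hq => (hest' q.1 hq.1 q.2).trans ?_⟩
    have h₁ : ‖S₁.chain.incl (hrM k) q.2‖ ≤ R := le_of_lt hq.2
    have h₂ : ‖q.1‖ ≤ ‖q‖ := norm_fst_le q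
    have h₃ : ‖q.2‖ ≤ ‖q‖ := norm_snd_le q
    have hR : 0 ≤ R := by positivity
    calc _ ≤ C * ((1 + ‖q‖) * R + (1 + ‖q‖)) := by
          gcongr
          linarith
      _ = _ := by ring

/-- All operators `Φ i` start at the single level `N`. With `E₁` rescaled to begin there, including
level `N + j` into level `N` before `Φ j` gives the envelope; replacing `Φ j` by `Φ (k j)` gives the
lift for `k`. -/
theorem isStronglySmoothing_of_isLocalSmoothing {c : ScContext} {U : Set E} (hU : IsOpen U)
    {κ : E → E₁ →ₗ[𝕜] E₂} (h : ∀ x ∈ U,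
      IsLocalSmoothing c (baseStructure 𝕜 E) (baseStructure 𝕜 E₁) (baseStructure 𝕜 E₂) x κ) :
    IsStronglySmoothing c U κ := by
  refine ⟨isFamily_of_isLocalFamily hU fun x hx => (h x hx).isLocalFamily, fun x₀ hx₀ => ?_⟩
  set S := baseStructure 𝕜 E
  set S₁ := baseStructure 𝕜 E₁
  set S₂ := baseStructure 𝕜 E₂
  obtain ⟨⟨V₁, hV₁, m, n, hm, hext⟩, htame⟩ := h x₀ hx₀
  obtain ⟨V₂, hV₂, r, htame⟩ : ∃ V ∈ 𝓝 x₀, ∃ r, c = ScContext.tame → ∀ k, ∃ C : ℝ, 0 ≤ C ∧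
      ∀ x ∈ V, ∀ u, ‖S₂.coord k (κ x u)‖ ≤
        C * ((1 + ‖S.coord (k + r) x‖) * ‖S₁.coord r u‖) := by
    by_cases hc : c = ScContext.tame
    · obtain ⟨V, hV, r, hr⟩ := htame hc
      exact ⟨V, hV, r, fun _ => hr⟩
    · exact ⟨univ, Filter.univ_mem, 0, fun hc' => absurd hc' hc⟩
  obtain ⟨p, ρ, hρ, hball⟩ := S.exists_ball_subset
    (Filter.inter_mem (Filter.inter_mem hV₁ hV₂) (hU.mem_nhds hx₀))
  set V := S.ball x₀ p ρ
  obtain ⟨M, hM, hmM, hpM, hkM⟩ : ∃ M, c.Admissible M ∧ (∀ k, m k ≤ M k) ∧ (∀ k, p ≤ M k) ∧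
      ∀ k, k + r ≤ M k :=
    ⟨_, hm.add (p + r), fun k => by omega, fun k => by omega, fun k => by
      have := hm.1.le_apply (x := k)
      omega⟩
  -- Level `N` becomes level zero of the rescaled chain. Because `r ≤ N`, its unit ball controls the
  -- vector norm in the tame estimate.
  obtain ⟨N, hnN, hrN⟩ : ∃ N, n ≤ N ∧ r ≤ N := ⟨max n r, le_max_left _ _, le_max_right _ _⟩
  have hN : c.Admissible fun k => N + k := c.admissible_add_left N
  obtain ⟨W, Φ, hW, hmaps, hWV, hΦ, hφ, hcomm⟩ := exists_nested_extensions hM.1.monotone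
    (monotone_const (c := N)) fun k => ((hext k).mono (hmM k) hnN le_rfl).restrict_ball
      (fun x hx => (hball hx).1.1) (hpM k)
  have hNj : ∀ j, N ≤ N + j := fun j => Nat.le_add_right N j
  have hcomm' : ∀ i j (hij : i ≤ j), ∀ x ∈ W j, ∀ u,
        Φ i (S.chain.incl (hM.1.monotone hij) x) u = S₂.chain.incl hij (Φ j x u) := by
    intro i j hij x hx u
    rw [← hcomm i j hij x hx u, ScChain.incl_self]
    rfl
  have hcont : ∀ i j, ContinuousOn (fun q : S.chain.X (M i) × S₁.chain.X (N + j) =>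
      Φ i q.1 (S₁.chain.incl (hNj j) q.2)) (W i ×ˢ univ) := fun i j =>
    ((hΦ i).comp continuous_fst.continuousOn fun q hq => hq.1).clm_apply
      ((S₁.chain.incl (hNj j)).continuous.comp continuous_snd).continuousOn
  have htame' : c = ScContext.tame → ∀ i j, ∃ C : ℝ, ∀ x ∈ W i, ∀ u : S₁.chain.X (N + j),
      ‖S₁.chain.incl (hNj j) u‖ < 1 →
      ‖Φ i x (S₁.chain.incl (hNj j) u)‖ ≤ C * (1 + ‖((x, u) : S.chain.X (M i) × _)‖) := by
    intro hc i j
    obtain ⟨C, hC, hest⟩ := htame hc i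
    have hest' : ∀ x ∈ W i, ∀ u, ‖Φ i x u‖ ≤ C * ((1 + ‖x‖) * ‖u‖) := by
      intro x hx u
      refine ((S.denseRange_coord (M i)).prodMap (S₁.denseRange_coord N)).le_of_isOpen
        (f := fun q => ‖Φ i q.1 q.2‖) (g := fun q => C * ((1 + ‖q.1‖) * ‖q.2‖))
        ((hW i).prod isOpen_univ) ?_ (by fun_prop) ?_ (x := (x, u)) ⟨hx, mem_univ _⟩
      · exact (((hΦ i).comp continuous_fst.continuousOn fun q hq => hq.1).clm_apply
          (by fun_prop)).norm
      rintro _ ⟨hq, -⟩ ⟨⟨d, d₁⟩, rfl⟩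
      have hd : d ∈ V := (hWV i d).1 hq
      simp only [Prod.map]
      rw [hφ i d hd]
      refine (hest d (hball hd).1.2 d₁).trans ?_
      have := S.norm_coord_mono (hkM i) d
      have := S₁.norm_coord_mono hrN d₁
      gcongr
    refine ⟨C, fun x hx u hu => (hest' x hx _).trans ?_⟩
    have h₂ : ‖x‖ ≤ ‖((x, u) : S.chain.X (M i) × _)‖ := norm_fst_le (x, u)
    calc _ ≤ C * ((1 + ‖((x, u) : S.chain.X (M i) × _)‖) * 1) := by gcongr
      _ = _ := by rw [mul_one]
  have heq : ∀ k : ℕ → ℕ, V ×ˢ (univ : Set E₁) = ⋂ j, (fun q : E × E₁ =>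
      (S.coord (M (k j)) q.1, S₁.coord (N + j) q.2)) ⁻¹' (W (k j) ×ˢ univ) := by
    intro k
    ext ⟨x, u⟩
    rw [mem_iInter]
    exact ⟨fun hq j => ⟨(hWV _ x).2 hq.1, mem_univ _⟩,
      fun hq => ⟨(hWV (k 0) x).1 (hq 0).1, mem_univ _⟩⟩
  have hextend : ∀ i j, ∀ a ∈ V ×ˢ (univ : Set E₁), Φ i (S.coord (M i) a.1)
      (S₁.chain.incl (hNj j) (S₁.coord (N + j) a.2)) = S₂.coord i (κ a.1 a.2) := by
    intro i j a ha
    rw [S₁.incl_coord, hφ i a.1 ha.1]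
  refine ⟨V, S.ball_mem_nhds x₀ p hρ, fun x hx => (hball hx).2, S.rescale M hM.1,
    S₁.rescale _ hN.1, S₂, W, fun j q => Φ j q.1 (S₁.chain.incl (hNj j) q.2),
    S.equivalent_rescale c hM, S₁.equivalent_rescale c hN, S₂.equivalent_refl c, ?_, ?_, ?_⟩
  · refine ⟨fun k => (hW k).prod isOpen_univ, ?_, heq fun j => j, fun k => hcont k k,
      fun k a ha => hextend k k a ha, ?_⟩
    · exact fun k q hq => ⟨hmaps k (k + 1) (Nat.le_succ k) hq.1, mem_univ _⟩
    · rintro k ⟨x, u⟩ ⟨hx, -⟩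
      have := hcomm' k (k + 1) (Nat.le_succ k) x hx (S₁.chain.incl (hNj (k + 1)) u)
      rw [ScChain.incl_one] at this
      rw [← this]
      change Φ k (S.chain.incl _ x) (S₁.chain.incl _ (S₁.chain.incl _ u)) = _
      rw [ScChain.incl_incl]
  · intro hc j
    obtain ⟨C, hC⟩ := htame' hc j j
    refine ⟨C, fun q hq => hC q.1 hq.1 q.2 ?_⟩
    rw [← S₁.chain.rescale_incl _ hN.1 (Nat.zero_le j)]
    exact hq.2
  · intro k hk
    refine ⟨fun j q => Φ (k j) q.1 (S₁.chain.incl (hNj j) q.2), ?_, ?_, ?_⟩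
    · have hι : ∀ j x, ((S.rescale M hM.1).rescale k hk.1).chain.ι j x =
          S.chain.incl (hM.1.monotone (hk.1.monotone (Nat.le_succ j))) x := fun j x =>
        congrArg (fun T => T x) (S.chain.rescale_incl M hM.1 (hk.1.monotone (Nat.le_succ j)))
      refine ⟨fun j => (hW (k j)).prod isOpen_univ, ?_, heq k, fun j => hcont (k j) j,
        fun j a ha => hextend (k j) j a ha, ?_⟩
      · rintro j ⟨x, u⟩ ⟨hx, -⟩
        refine ⟨?_, mem_univ _⟩
        change ((S.rescale M hM.1).rescale k hk.1).chain.ι j x ∈ _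
        rw [hι]
        exact hmaps _ _ (hk.1.monotone (Nat.le_succ j)) hx
      · rintro j ⟨x, u⟩ ⟨hx, -⟩
        have := hcomm' _ _ (hk.1.monotone (Nat.le_succ j)) x hx (S₁.chain.incl (hNj (j + 1)) u)
        change Φ (k j) (((S.rescale M hM.1).rescale k hk.1).chain.ι j x)
          (S₁.chain.incl _ (S₁.chain.incl _ u)) = S₂.chain.incl _ _
        rw [hι, ← this, ScChain.incl_incl]
    · intro hc j
      obtain ⟨C, hC⟩ := htame' hc (k j) j
      refine ⟨C, fun q hq => hC q.1 hq.1 q.2 ?_⟩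
      rw [← S₁.chain.rescale_incl _ hN.1 (Nat.zero_le j)]
      exact hq.2
    · intro j x hx u
      rw [S.chain.rescale_incl M hM.1]
      exact hcomm' _ _ (hk.1.le_apply (x := j)) x hx _

end Construction

/-! ### Inverting smoothing perturbations of the identity. -/

section Neumann

variable {𝕜 : Type v} [RCLike 𝕜]
variable {E : Type u} [AddCommGroup E] [Module 𝕜 E] [TopologicalSpace E]
variable {E₁ : Type u₁} [AddCommGroup E₁] [Module 𝕜 E₁] [TopologicalSpace E₁]

theorem ScStructure.exists_linearMap_coord_eq {D : Type*} [AddCommGroup D] [Module 𝕜 D]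
    (S : ScStructure 𝕜 E) (T : ∀ k, D →ₗ[𝕜] S.chain.X k)
    (hT : ∀ k u, S.chain.ι k (T (k + 1) u) = T k u) :
    ∃ A : D →ₗ[𝕜] E, ∀ k u, S.coord k (A u) = T k u := by
  choose A hA using fun u => S.exists_coord_eq (y := fun k => T k u) fun k => hT k u
  refine ⟨{ toFun := A, map_add' := fun u w => ?_, map_smul' := fun a u => ?_ }, fun k u => hA u k⟩
  · exact S.ext_coord fun k => by rw [map_add, hA, hA, hA, map_add]
  · exact S.ext_coord fun k => by rw [map_smul, hA, hA, map_smul]; rfl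

/-- A strongly smoothing perturbation of the identity that vanishes at `x₀` is invertible near
`x₀`, and the inverse is again a strongly smoothing perturbation of the identity. -/
theorem IsLocalSmoothing.exists_inverse {c : ScContext} {S : ScStructure 𝕜 E}
    {S₁ : ScStructure 𝕜 E₁} {x₀ : E} {κ : E → E₁ →ₗ[𝕜] E₁}
    (hκ : IsLocalSmoothing c S S₁ S₁ x₀ κ) (h₀ : κ x₀ = 0) :
    ∃ (V : Set E) (κ' : E → E₁ →ₗ[𝕜] E₁), IsOpen V ∧ x₀ ∈ V ∧ κ' x₀ = 0 ∧
      (∀ x ∈ V, IsLocalSmoothing c S S₁ S₁ x κ') ∧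
      ∀ x ∈ V, (LinearMap.id + κ x).comp (LinearMap.id + κ' x) = LinearMap.id ∧
        (LinearMap.id + κ' x).comp (LinearMap.id + κ x) = LinearMap.id := by
  classical
  obtain ⟨⟨V₁, hV₁, m, n, hm, hext⟩, htame⟩ := hκ
  obtain ⟨V₂, hV₂, r, htame⟩ : ∃ V ∈ 𝓝 x₀, ∃ r, c = ScContext.tame → ∀ k, ∃ C : ℝ, 0 ≤ C ∧
      ∀ x ∈ V, ∀ u, ‖S₁.coord k (κ x u)‖ ≤
        C * ((1 + ‖S.coord (k + r) x‖) * ‖S₁.coord r u‖) := by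
    by_cases hc : c = ScContext.tame
    · obtain ⟨V, hV, r, hr⟩ := htame hc
      exact ⟨V, hV, r, fun _ => hr⟩
    · exact ⟨univ, Filter.univ_mem, 0, fun hc' => absurd hc' hc⟩
  obtain ⟨N, hnN, hrN⟩ : ∃ N, n ≤ N ∧ r ≤ N := ⟨max n r, le_max_left _ _, le_max_right _ _⟩
  choose W Φ hW hWV hΦ hφ using fun k => (hext k).mono (le_refl (m k)) hnN (le_refl k)
  -- The only inversion takes place at level `N`, where inversion is continuous on the open set of
  -- units. The bound by two in `O` is what the tame estimate of the inverse uses.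
  let b : S.chain.X (m N) → S₁.chain.X N →L[𝕜] S₁.chain.X N := fun x => Ring.inverse (1 + Φ N x)
  let O : Set (S₁.chain.X N →L[𝕜] S₁.chain.X N) := {T | IsUnit T ∧ ‖Ring.inverse T‖ < 2}
  have hinv : ContinuousOn (Ring.inverse : (S₁.chain.X N →L[𝕜] S₁.chain.X N) → _)
      {T | IsUnit T} := by
    rintro _ ⟨T, rfl⟩
    exact (NormedRing.inverse_continuousAt T).continuousWithinAt
  have hO : IsOpen O := hinv.norm.isOpen_inter_preimage Units.isOpen isOpen_Iio
  have hΦ1 : ContinuousOn (fun x => 1 + Φ N x) (W N) := continuousOn_const.add (hΦ N)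
  let W' : Set (S.chain.X (m N)) := W N ∩ (fun x => 1 + Φ N x) ⁻¹' O
  have hW' : IsOpen W' := hΦ1.isOpen_inter_preimage (hW N) hO
  have hb : ContinuousOn b W' := hinv.comp (hΦ1.mono inter_subset_left) fun x hx => hx.2.1
  let Va : Set E := S.coord (m N) ⁻¹' W'
  have hVa : IsOpen Va := hW'.preimage (S.coord (m N)).continuous
  have hVa₁ : Va ⊆ V₁ := fun x hx => (hWV N x).1 hx.1
  have hab : ∀ x ∈ Va, ∀ v, b (S.coord (m N) x) v +
      Φ N (S.coord (m N) x) (b (S.coord (m N) x) v) = v := fun x hx v =>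
    congrArg (fun T => T v) (Ring.mul_inverse_cancel _ hx.2.1)
  have hba : ∀ x ∈ Va, ∀ v, b (S.coord (m N) x) (v + Φ N (S.coord (m N) x) v) = v :=
    fun x hx v => congrArg (fun T => T v) (Ring.inverse_mul_cancel _ hx.2.1)
  have hzero : ∀ k, Φ k (S.coord (m k) x₀) = 0 := by
    intro k
    refine ContinuousLinearMap.ext fun v => ?_
    refine congrFun ((S₁.denseRange_coord N).equalizer (Φ k _).continuous continuous_zero ?_) v
    funext u
    rw [Function.comp_apply, hφ k x₀ (mem_of_mem_nhds hV₁), h₀, LinearMap.zero_apply, map_zero]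
    rfl
  have hx₀ : x₀ ∈ Va := by
    refine ⟨(hWV N x₀).2 (mem_of_mem_nhds hV₁), ?_⟩
    rw [mem_preimage, hzero, add_zero]
    refine ⟨isUnit_one, ?_⟩
    rw [Ring.inverse_one]
    exact lt_of_le_of_lt ContinuousLinearMap.norm_id_le one_lt_two
  -- The formula `κ' = -κ (id + κ)⁻¹`, read at every level: `b` is applied at level `N`, and then `Φ
  -- k` leads to level `k`. Compatibility of the `Φ k` makes the values an element of `E₁`.
  have hex : ∀ x, ∃ A : E₁ →ₗ[𝕜] E₁, x ∈ Va → ∀ k u, S₁.coord k (A u) =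
      -Φ k (S.coord (m k) x) (b (S.coord (m N) x) (S₁.coord N u)) := by
    intro x
    by_cases hx : x ∈ Va
    · have hcomm : ∀ k v, S₁.chain.ι k (Φ (k + 1) (S.coord (m (k + 1)) x) v) =
          Φ k (S.coord (m k) x) v := by
        intro k
        refine congrFun ((S₁.denseRange_coord N).equalizer
          ((S₁.chain.ι k).continuous.comp (Φ (k + 1) _).continuous) (Φ k _).continuous ?_)
        funext u
        simp only [Function.comp_apply]
        rw [hφ (k + 1) x (hVa₁ hx), hφ k x (hVa₁ hx), S₁.ι_coord]
      obtain ⟨A, hA⟩ := S₁.exists_linearMap_coord_eq (fun k =>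
        ((-Φ k (S.coord (m k) x)).comp ((b (S.coord (m N) x)).comp (S₁.coord N))).toLinearMap)
        (fun k u => by
          change S₁.chain.ι k (-Φ (k + 1) (S.coord (m (k + 1)) x) _) = -Φ k (S.coord (m k) x) _
          rw [map_neg, hcomm])
      exact ⟨A, fun _ k u => hA k u⟩
    · exact ⟨0, fun hx' => absurd hx' hx⟩
  choose κ' hκ' using hex
  have hcN : ∀ x ∈ Va, ∀ u, S₁.coord N (u + κ' x u) = b (S.coord (m N) x) (S₁.coord N u) := by
    intro x hx u
    rw [map_add, hκ' x hx]
    nth_rewrite 1 [← hab x hx (S₁.coord N u)]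
    rw [add_neg_cancel_right]
  -- Since `E₁` injects into level `N`, the identities of the inverse need checking only there.
  have hright : ∀ x ∈ Va, ∀ u, u + κ' x u + κ x (u + κ' x u) = u := by
    intro x hx u
    apply S₁.coord_injective N
    rw [map_add, ← hφ N x (hVa₁ hx), hcN x hx, hab x hx]
  have hleft : ∀ x ∈ Va, ∀ u, u + κ x u + κ' x (u + κ x u) = u := by
    intro x hx u
    apply S₁.coord_injective N
    rw [hcN x hx, map_add, ← hφ N x (hVa₁ hx), hba x hx]
  have hκext : ∀ k, ExtendsToLevels S S₁ S₁ Va κ' (m (k + N)) N k := by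
    intro k
    have h₁ : m k ≤ m (k + N) := hm.1.monotone (Nat.le_add_right k N)
    have h₂ : m N ≤ m (k + N) := hm.1.monotone (Nat.le_add_left N k)
    refine ⟨S.chain.incl h₁ ⁻¹' W k ∩ S.chain.incl h₂ ⁻¹' W',
      fun x => -(Φ k (S.chain.incl h₁ x)).comp (b (S.chain.incl h₂ x)),
      ((hW k).preimage (S.chain.incl h₁).continuous).inter
        (hW'.preimage (S.chain.incl h₂).continuous), fun x => ?_, ?_, fun x hx u => ?_⟩
    · rw [mem_inter_iff, mem_preimage, mem_preimage, S.incl_coord, S.incl_coord, hWV]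
      exact ⟨fun hx => hx.2, fun hx => ⟨hVa₁ hx, hx⟩⟩
    · refine ContinuousOn.neg (ContinuousOn.clm_comp ?_ ?_)
      · exact (hΦ k).comp (S.chain.incl h₁).continuous.continuousOn fun x hx => hx.1
      · exact hb.comp (S.chain.incl h₂).continuous.continuousOn fun x hx => hx.2
    · rw [hκ' x hx]
      dsimp only
      rw [S.incl_coord, S.incl_coord]
      rfl
  refine ⟨Va ∩ interior V₂, κ', hVa.inter isOpen_interior,
    ⟨hx₀, mem_interior_iff_mem_nhds.2 hV₂⟩, ?_, fun x hx => ⟨?_, fun hc => ?_⟩,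
    fun x hx => ⟨LinearMap.ext fun u => hright x hx.1 u, LinearMap.ext fun u => hleft x hx.1 u⟩⟩
  · refine LinearMap.ext fun u => S₁.ext_coord fun k => ?_
    rw [hκ' x₀ hx₀, hzero]
    simp
  · exact ⟨Va, hVa.mem_nhds hx.1, _, N, hm.comp (c.admissible_add N), hκext⟩
  · refine ⟨Va ∩ interior V₂, (hVa.inter isOpen_interior).mem_nhds hx, N, fun k => ?_⟩
    obtain ⟨C, hC, hest⟩ := htame hc k
    refine ⟨C * 2, by positivity, fun x hx u => ?_⟩
    -- The estimate of `κ` is applied to `u + κ' x u`, whose level `N` norm is at most twice that of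
    -- `u` by the bound on `b`.
    have h₁ : κ' x u = -κ x (u + κ' x u) := by
      rw [eq_neg_iff_add_eq_zero]
      have := hright x hx.1 u
      rwa [add_assoc, add_eq_left] at this
    have h₂ := hest x (interior_subset hx.2) (u + κ' x u)
    have h₃ := S₁.norm_coord_mono hrN (u + κ' x u)
    rw [hcN x hx.1] at h₃
    have h₄ := (b (S.coord (m N) x)).le_of_opNorm_le (le_of_lt hx.1.2.2) (S₁.coord N u)
    have h₅ := S.norm_coord_mono (show k + r ≤ k + N by omega) x
    rw [h₁, map_neg, norm_neg]
    calc _ ≤ C * ((1 + ‖S.coord (k + N) x‖) * (2 * ‖S₁.coord N u‖)) := by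
          refine h₂.trans ?_
          gcongr
          exact h₃.trans h₄
      _ = _ := by ring

end Neumann

/-! ### Riesz theory and the algebra of parametrices. -/

section Riesz

variable {𝕜 : Type*} [RCLike 𝕜]

/-- A linear map with finite-dimensional kernel and cokernel of equal dimensions. -/
def IsFredholmOfIndexZero {D D' : Type*} [AddCommGroup D] [Module 𝕜 D] [AddCommGroup D']
    [Module 𝕜 D'] (T : D →ₗ[𝕜] D') : Prop :=
  FiniteDimensional 𝕜 (LinearMap.ker T) ∧ FiniteDimensional 𝕜 (D' ⧸ LinearMap.range T) ∧
    T.index = 0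

section Banach

variable {X : Type*} [NormedAddCommGroup X] [NormedSpace 𝕜 X] {a : X →L[𝕜] X}

/-- On the kernel the compact operator `-a` is the identity, and a space with compact identity has
finite dimension. -/
theorem IsCompactOperator.finiteDimensional_ker_id_add [CompleteSpace X]
    (ha : IsCompactOperator a) :
    FiniteDimensional 𝕜 (LinearMap.ker (LinearMap.id + a.toLinearMap)) := by
  set N := LinearMap.ker (LinearMap.id + a.toLinearMap)
  have hmem : ∀ v ∈ N, v + a v = 0 := fun v hv => hv
  have hcl : IsClosed (N : Set X) := (ContinuousLinearMap.id 𝕜 X + a).isClosed_ker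
  have hN : ∀ v ∈ N, (-a).toLinearMap v = v := fun v hv =>
    (eq_neg_of_add_eq_zero_left (hmem v hv)).symm
  have hN' : ∀ v ∈ N, (-a).toLinearMap v ∈ N := fun v hv => (hN v hv).symm ▸ hv
  have hc : IsCompactOperator ((-a).toLinearMap) := ha.neg
  have h := hc.restrict hN' hcl
  refine FiniteDimensional.of_isCompactOperator_id (𝕜 := 𝕜) ?_
  have hid : ((-a).toLinearMap.restrict hN') = LinearMap.id :=
    LinearMap.ext fun v => Subtype.ext (hN v v.2)
  rw [hid] at h
  exact h

/-- The Fredholm alternative for `-a` at the value one: injectivity excludes an eigenvector, so one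
lies in the resolvent set. -/
theorem IsCompactOperator.surjective_id_add [CompleteSpace X] (ha : IsCompactOperator a)
    (hinj : ∀ x, x + a x = 0 → x = 0) (y : X) : ∃ x, x + a x = y := by
  have hc : IsCompactOperator (-a) := ha.neg
  rcases hc.hasEigenvalue_or_mem_resolventSet (μ := (1 : 𝕜)) one_ne_zero with h | h
  · obtain ⟨v, hv⟩ := h.exists_hasEigenvector
    have h₁ : -a v = v := by simpa using hv.apply_eq_smul
    exact absurd (hinj v (by nth_rewrite 1 [← h₁]; simp)) hv.2
  · obtain ⟨S, hS⟩ := h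
    refine ⟨(↑S⁻¹ : X →L[𝕜] X) y, ?_⟩
    have h₁ := congrArg (fun T => T y) S.mul_inv
    rw [hS] at h₁
    simpa using h₁

/-- On a closed complement of the kernel `id + a` is bijective, and its inverse gives a bounded
right inverse `R` of `id + a`. Then `R = id - a R` is an injective compact perturbation of the
identity, hence surjective. A kernel vector `R y` satisfies `y = (id + a) (R y) = 0`. -/
theorem IsCompactOperator.injective_id_add [CompleteSpace X] (ha : IsCompactOperator a)
    (hsurj : ∀ y, ∃ x, x + a x = y) {x : X} (hx : x + a x = 0) : x = 0 := by
  have := ha.finiteDimensional_ker_id_add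
  set N := LinearMap.ker (LinearMap.id + a.toLinearMap)
  obtain ⟨P, hP⟩ := Submodule.ClosedComplemented.of_finiteDimensional N
  have hPN : ∀ v, P v + a (P v) = (0 : X) := fun v => (P v).2
  let C := LinearMap.ker P.toLinearMap
  have hC : IsClosed (C : Set X) := P.isClosed_ker
  have : CompleteSpace C := hC.completeSpace_coe
  let T : C →L[𝕜] X := (ContinuousLinearMap.id 𝕜 X + a).comp C.subtypeL
  have hT : ∀ v : C, T v = v + a v := fun v => rfl
  have hTinj : LinearMap.ker T.toLinearMap = ⊥ := by
    refine LinearMap.ker_eq_bot'.2 fun v hv => ?_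
    have h₁ : (v : X) ∈ N := hv
    have h₂ := hP ⟨v, h₁⟩
    have h₃ : P v = 0 := v.2
    rw [h₃] at h₂
    exact Subtype.ext (congrArg Subtype.val h₂).symm
  have hTsurj : LinearMap.range T.toLinearMap = ⊤ := by
    refine LinearMap.range_eq_top.2 fun y => ?_
    obtain ⟨w, hw⟩ := hsurj y
    refine ⟨⟨w - P w, ?_⟩, ?_⟩
    · change P (w - P w) = 0
      rw [map_sub, hP, sub_self]
    · change (w - P w : X) + a (w - P w) = y
      rw [map_sub, ← hw, sub_add_sub_comm, hPN w, sub_zero]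
  let e := ContinuousLinearEquiv.ofBijective T hTinj hTsurj
  let R : X →L[𝕜] X := C.subtypeL.comp (e.symm : X →L[𝕜] C)
  have hR : ∀ y, R y + a (R y) = y := fun y => e.apply_symm_apply y
  have hRc : IsCompactOperator (-(a.comp R)) := (ha.comp_clm R).neg
  obtain ⟨y, hy⟩ := hRc.surjective_id_add (fun y hy => by
    have h₁ : R y = 0 := by
      have h₂ : y + -a (R y) = 0 := hy
      rw [← sub_eq_add_neg, sub_eq_zero] at h₂
      exact add_eq_right.1 ((hR y).trans h₂)
    rw [← hR y, h₁]; simp) x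
  have h₁ : R y = x := by
    have h₂ : y + -a (R y) = x := hy
    rw [← h₂]
    nth_rewrite 2 [← hR y]
    abel
  have h₂ := hR y
  rw [h₁, hx] at h₂
  rw [← h₁, ← h₂, map_zero]

/-- The Riesz theorem: a compact perturbation of the identity is Fredholm of index zero. -/
theorem IsCompactOperator.isFredholmOfIndexZero [CompleteSpace X] (ha : IsCompactOperator a) :
    IsFredholmOfIndexZero (LinearMap.id + a.toLinearMap) := by
  have hfin := ha.finiteDimensional_ker_id_add
  set T := LinearMap.id + a.toLinearMap with hT
  have hTv : ∀ v, T v = v + a v := fun v => rfl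
  set N := LinearMap.ker T
  let R := LinearMap.range T
  obtain ⟨P, hP⟩ := Submodule.ClosedComplemented.of_finiteDimensional N
  have hTP : ∀ v, T (P v) = 0 := fun v => (P v).2
  obtain ⟨s, hs⟩ := R.mkQ.exists_rightInverse_of_surjective (Submodule.range_mkQ R)
  have hs' : ∀ q, R.mkQ (s q) = q := fun q => congrArg (fun f => f q) hs
  have hmkT : ∀ v, R.mkQ (T v) = 0 := fun v =>
    (Submodule.Quotient.mk_eq_zero R).2 (LinearMap.mem_range_self T v)
  -- A map `G` from kernel to cokernel, lifted to `F`, gives the finite rank perturbation `T + F P`,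
  -- again compact plus identity. It inherits injectivity or surjectivity from `G`, has the other
  -- property by the preceding two lemmas, and passes it back to `G`.
  have key : ∀ G : N →ₗ[𝕜] X ⧸ R, Function.Injective G ∨ Function.Surjective G →
      Function.Bijective G := by
    intro G hG
    let F : N →L[𝕜] X := LinearMap.toContinuousLinearMap (s.comp G)
    have hF : ∀ n, R.mkQ (F n) = G n := fun n => hs' (G n)
    have : ProperSpace N := FiniteDimensional.proper_rclike 𝕜 N
    let b : X →L[𝕜] X := a + F.comp P
    have hb : IsCompactOperator b :=
      ha.add ((isCompactOperator_of_locallyCompactSpace_rng F).comp_clm P)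
    have hbv : ∀ v, v + b v = T v + F (P v) := fun v => (add_assoc v (a v) (F (P v))).symm
    rcases hG with hG | hG
    · refine ⟨hG, fun q => ?_⟩
      obtain ⟨y, rfl⟩ := R.mkQ_surjective q
      obtain ⟨w, rfl⟩ := hb.surjective_id_add (fun w hw => by
        rw [hbv] at hw
        have h₁ := congrArg R.mkQ hw
        rw [map_add, hmkT, zero_add, hF, map_zero] at h₁
        have h₂ : P w = 0 := hG (h₁.trans (map_zero G).symm)
        rw [h₂, map_zero, add_zero] at hw
        have h₃ := hP ⟨w, hw⟩
        rw [h₂] at h₃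
        exact (congrArg Subtype.val h₃).symm) y
      exact ⟨P w, by rw [hbv, map_add, hmkT, zero_add, hF]⟩
    · refine ⟨(injective_iff_map_eq_zero G).2 fun q hq => ?_, hG⟩
      have hc : ∀ w : X, P (w - P w) = 0 := fun w => by rw [map_sub, hP, sub_self]
      have hTc : ∀ w : X, T (w - P w) = T w := fun w => by rw [map_sub, hTP, sub_zero]
      have hFq : F q ∈ R := by
        rw [← Submodule.Quotient.mk_eq_zero, ← Submodule.mkQ_apply, hF, hq]
      obtain ⟨w, hw⟩ := hFq
      have h₁ := hb.injective_id_add (fun y => by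
        obtain ⟨n, hn⟩ := hG (R.mkQ y)
        rw [← hF] at hn
        obtain ⟨z, hz⟩ : y - F n ∈ R := by
          rw [← Submodule.Quotient.mk_eq_zero, ← Submodule.mkQ_apply, map_sub, hn, sub_self]
        refine ⟨z - P z + n, ?_⟩
        have hTn : T n = 0 := n.2
        rw [hbv, map_add, map_add, hc, hTc, zero_add, hP, hz, hTn, add_zero, sub_add_cancel])
        (x := (q : X) - (w - P w)) (by
          have hTq : T q = 0 := q.2
          rw [hbv, map_sub T, map_sub P, hTc, hc, hP, hTq, hw, sub_zero, zero_sub,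
            neg_add_cancel])
      rw [sub_eq_zero] at h₁
      have h₂ := hP q
      rw [h₁, hc] at h₂
      exact h₂.symm
  obtain ⟨G, hG⟩ : ∃ G : N →ₗ[𝕜] X ⧸ R, Function.Bijective G := by
    -- Comparability of cardinals supplies an injective or a surjective `G`. The cokernel need not
    -- be known to have finite dimension: this follows from bijectivity.
    rcases le_total (Module.rank 𝕜 N) (Module.rank 𝕜 (X ⧸ R)) with h | h
    · obtain ⟨G, hG⟩ := rank_le_iff_exists_linearMap.1 h
      exact ⟨G, key G (Or.inl hG)⟩
    · obtain ⟨H, hH⟩ := rank_le_iff_exists_linearMap.1 h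
      obtain ⟨G, hG⟩ := H.exists_leftInverse_of_injective (LinearMap.ker_eq_bot.2 hH)
      exact ⟨G, key G (Or.inr fun q => ⟨H q, congrArg (fun f => f q) hG⟩)⟩
  let e := LinearEquiv.ofBijective G hG
  refine ⟨hfin, Module.Finite.equiv e, ?_⟩
  rw [LinearMap.index_eq_finrank_sub, e.finrank_eq, sub_self]

end Banach

/-- Regularity: `a` takes values in the image of `j`, so `v + a v` in that image forces `v` into it.
Thus kernels agree and `j` is injective on cokernels; it is surjective there since `v` and `-a v`
differ by `(id + a) v`. -/
theorem IsFredholmOfIndexZero.of_intertwine {D X : Type*} [AddCommGroup D] [Module 𝕜 D]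
    [AddCommGroup X] [Module 𝕜 X] {κ : D →ₗ[𝕜] D} {a : X →ₗ[𝕜] X} (j : D →ₗ[𝕜] X)
    (hj : Function.Injective j) (hja : ∀ u, j (κ u) = a (j u)) (hrange : ∀ v, ∃ u, j u = a v)
    (h : IsFredholmOfIndexZero (LinearMap.id + a)) :
    IsFredholmOfIndexZero (LinearMap.id + κ) := by
  obtain ⟨h₁, h₂, h₃⟩ := h
  have hcomm : ∀ u, j ((LinearMap.id + κ : D →ₗ[𝕜] D) u) = (LinearMap.id + a : X →ₗ[𝕜] X) (j u) := by
    intro u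
    simp [hja]
  have hpre : ∀ v u, (LinearMap.id + a : X →ₗ[𝕜] X) v = j u → ∃ w, j w = v := by
    intro v u hv
    obtain ⟨w, hw⟩ := hrange v
    refine ⟨u - w, ?_⟩
    rw [map_sub, ← hv, hw]
    simp
  let e₁ : LinearMap.ker (LinearMap.id + κ) ≃ₗ[𝕜] LinearMap.ker (LinearMap.id + a) :=
    LinearEquiv.ofBijective (j.restrict fun u hu => by
      rw [LinearMap.mem_ker, ← hcomm, LinearMap.mem_ker.1 hu, map_zero]) (by
      constructor
      · intro u w huw
        exact Subtype.ext (hj (congrArg Subtype.val huw))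
      · rintro ⟨v, hv⟩
        obtain ⟨w, rfl⟩ := hpre v 0 (by rw [map_zero]; exact hv)
        refine ⟨⟨w, ?_⟩, rfl⟩
        rw [LinearMap.mem_ker, ← hcomm] at hv
        exact hj (hv.trans (map_zero j).symm))
  let e₂ : (D ⧸ LinearMap.range (LinearMap.id + κ)) ≃ₗ[𝕜]
      (X ⧸ LinearMap.range (LinearMap.id + a)) :=
    LinearEquiv.ofBijective ((LinearMap.range (LinearMap.id + κ)).mapQ
      (LinearMap.range (LinearMap.id + a)) j (by
        rintro _ ⟨u, rfl⟩
        exact ⟨j u, (hcomm u).symm⟩)) (by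
      constructor
      · refine (injective_iff_map_eq_zero _).2 fun q hq => ?_
        obtain ⟨u, rfl⟩ := Submodule.mkQ_surjective _ q
        rw [Submodule.mkQ_apply, Submodule.mapQ_apply, Submodule.Quotient.mk_eq_zero] at hq
        obtain ⟨v, hv⟩ := hq
        obtain ⟨w, rfl⟩ := hpre v u hv
        rw [Submodule.mkQ_apply, Submodule.Quotient.mk_eq_zero]
        exact ⟨w, hj ((hcomm w).trans hv)⟩
      · intro q
        obtain ⟨v, rfl⟩ := Submodule.mkQ_surjective _ q
        obtain ⟨w, hw⟩ := hrange v
        refine ⟨Submodule.Quotient.mk (-w), ?_⟩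
        rw [Submodule.mapQ_apply, Submodule.mkQ_apply, Submodule.Quotient.eq]
        refine ⟨-v, ?_⟩
        rw [map_neg, map_neg j, hw]
        simp
        abel)
  refine ⟨Module.Finite.equiv e₁.symm, Module.Finite.equiv e₂.symm, ?_⟩
  rw [LinearMap.index_eq_finrank_sub, e₁.finrank_eq, e₂.finrank_eq,
    ← LinearMap.index_eq_finrank_sub, h₃]

/-- An operator with a two-sided parametrix modulo operators of index zero is Fredholm, and the
index of the parametrix is the negative of its index. -/
theorem IsFredholmOfIndexZero.of_parametrix {D D' : Type*} [AddCommGroup D] [Module 𝕜 D]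
    [AddCommGroup D'] [Module 𝕜 D'] {T : D →ₗ[𝕜] D'} {S : D' →ₗ[𝕜] D}
    (h : IsFredholmOfIndexZero (S.comp T)) (h' : IsFredholmOfIndexZero (T.comp S)) :
    FiniteDimensional 𝕜 (LinearMap.ker T) ∧ FiniteDimensional 𝕜 (D' ⧸ LinearMap.range T) ∧
      T.index = -S.index := by
  obtain ⟨h₁, h₂, h₃⟩ := h
  obtain ⟨h₁', h₂', h₃'⟩ := h'
  have hT : FiniteDimensional 𝕜 (LinearMap.ker T) :=
    Submodule.finiteDimensional_of_le (LinearMap.ker_le_ker_comp T S)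
  have hS : FiniteDimensional 𝕜 (LinearMap.ker S) :=
    Submodule.finiteDimensional_of_le (LinearMap.ker_le_ker_comp S T)
  have hT' : FiniteDimensional 𝕜 (D' ⧸ LinearMap.range T) :=
    Module.Finite.of_surjective _ (Submodule.factor_surjective (LinearMap.range_comp_le_range S T))
  have hS' : FiniteDimensional 𝕜 (D ⧸ LinearMap.range S) :=
    Module.Finite.of_surjective _ (Submodule.factor_surjective (LinearMap.range_comp_le_range T S))
  refine ⟨hT, hT', ?_⟩
  rw [LinearMap.index_comp] at h₃
  omega

end Riesz

/-! ### Fredholm families, their index, and the invertibility statement. -/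

section Fredholm

variable {𝕜 : Type v} [RCLike 𝕜]
variable {E : Type u} [AddCommGroup E] [Module 𝕜 E] [TopologicalSpace E]
variable {E' : Type u'} [AddCommGroup E'] [Module 𝕜 E'] [TopologicalSpace E']
variable {E₁ : Type u₁} [AddCommGroup E₁] [Module 𝕜 E₁] [TopologicalSpace E₁]
variable {E₂ : Type u₂} [AddCommGroup E₂] [Module 𝕜 E₂] [TopologicalSpace E₂]
variable {E₃ : Type u₃} [AddCommGroup E₃] [Module 𝕜 E₃] [TopologicalSpace E₃]
variable {c : ScContext}

section Structures

variable {S : ScStructure 𝕜 E} {S₁ : ScStructure 𝕜 E₁} {S₂ : ScStructure 𝕜 E₂} {x : E}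

/-- At level `n` the extension of `κ x` factors through level `n + 1`, hence is compact. It also
extends compatibly to all levels, so its values lie in `E₁`; Riesz theory on level `n` therefore
descends to `E₁`. -/
theorem IsLocalSmoothing.isFredholmOfIndexZero {κ : E → E₁ →ₗ[𝕜] E₁}
    (h : IsLocalSmoothing c S S₁ S₁ x κ) : IsFredholmOfIndexZero (LinearMap.id + κ x) := by
  obtain ⟨V, hV, m, n, -, h⟩ := h.1
  have hx := mem_of_mem_nhds hV
  choose W Φ _ _ _ hΦ using h
  have hcomp : ∀ k v, S₁.chain.ι k (Φ (k + 1) (S.coord (m (k + 1)) x) v) =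
      Φ k (S.coord (m k) x) v := by
    intro k v
    refine congrFun ((S₁.denseRange_coord n).equalizer
      ((S₁.chain.ι k).comp (Φ (k + 1) (S.coord (m (k + 1)) x))).continuous
      (Φ k (S.coord (m k) x)).continuous (funext fun u => ?_)) v
    change S₁.chain.ι k (Φ (k + 1) (S.coord (m (k + 1)) x) (S₁.coord n u)) =
      Φ k (S.coord (m k) x) (S₁.coord n u)
    rw [hΦ _ x hx, hΦ _ x hx, S₁.ι_coord]
  let a : S₁.chain.X n →L[𝕜] S₁.chain.X n :=
    (S₁.chain.ι n).comp (Φ (n + 1) (S.coord (m (n + 1)) x))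
  have ha : IsCompactOperator a := (S₁.chain.ι_compact n).comp_clm _
  refine ha.isFredholmOfIndexZero.of_intertwine (S₁.coord n).toLinearMap (S₁.coord_injective n)
    (fun u => ?_) (fun v => ?_)
  · exact ((hcomp n _).trans (hΦ n x hx u)).symm
  · obtain ⟨u, hu⟩ := S₁.exists_coord_eq (y := fun k => Φ k (S.coord (m k) x) v)
      fun k => hcomp k v
    exact ⟨u, (hu n).trans (hcomp n v).symm⟩

theorem IsLocalFamily.continuous {φ : E → E₁ →ₗ[𝕜] E₂} (h : IsLocalFamily c S S₁ S₂ x φ) :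
    Continuous (φ x) := by
  obtain ⟨V, hV, m, -, h⟩ := h.1
  refine continuous_iff_continuousAt.2 fun u => S₂.continuousAt_of_coord fun k => ?_
  obtain ⟨W, Φ, -, -, -, hΦ⟩ := h k
  simp only [← hΦ x (mem_of_mem_nhds hV)]
  fun_prop

end Structures

theorem IsFredholmOperator.fredholmIndex_comp {T : E₁ →ₗ[𝕜] E₂} {R : E₂ →ₗ[𝕜] E₃}
    (hR : IsFredholmOperator R) (hT : IsFredholmOperator T) :
    fredholmIndex (R.comp T) = fredholmIndex R + fredholmIndex T := by
  have := hR.2.1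
  have := hR.2.2
  have := hT.2.1
  have := hT.2.2
  have h := LinearMap.index_comp R (f := T)
  simpa only [LinearMap.index_eq_finrank_sub, fredholmIndex] using h

variable [ScFrechetSpace 𝕜 E] [ScFrechetSpace 𝕜 E'] [ScFrechetSpace 𝕜 E₁] [ScFrechetSpace 𝕜 E₂]
  [ScFrechetSpace 𝕜 E₃]
variable {U : Set E}

theorem IsFredholmFamily.exists_parametrix {φ : E → E₁ →ₗ[𝕜] E₂} (h : IsFredholmFamily c U φ)
    {x : E} (hx : x ∈ U) : ∃ ψ : E₂ →ₗ[𝕜] E₁, IsFredholmOfIndexZero (ψ.comp (φ x)) ∧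
      IsFredholmOfIndexZero ((φ x).comp ψ) := by
  obtain ⟨V, -, hxV, -, ψ, κ, κ', -, hκ, hκ', heq⟩ := h.2 x hx
  refine ⟨ψ x, ?_, ?_⟩
  · rw [(heq x hxV).1]
    exact (hκ.isLocalSmoothing hxV).isFredholmOfIndexZero
  · rw [(heq x hxV).2]
    exact (hκ'.isLocalSmoothing hxV).isFredholmOfIndexZero

theorem IsFredholmFamily.isFredholmOperator {φ : E → E₁ →ₗ[𝕜] E₂} (h : IsFredholmFamily c U φ)
    {x : E} (hx : x ∈ U) : IsFredholmOperator (φ x) := by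
  obtain ⟨ψ, h₁, h₂⟩ := h.exists_parametrix hx
  have h₃ := h₁.of_parametrix h₂
  exact ⟨(h.1.isLocalFamily hx).continuous, h₃.1, h₃.2.1⟩

theorem IsFredholmFamily.pullback {U' : Set E'} {f : E' → E} {φ : E → E₁ →ₗ[𝕜] E₂}
    (hU' : IsOpen U') (hfU : MapsTo f U' U) (hf : IsScContinuousOn 𝕜 c U' f)
    (h : IsFredholmFamily c U φ) : IsFredholmFamily c U' (fun x' => φ (f x')) := by
  refine ⟨isFamily_of_isLocalFamily hU' fun x hx =>
    (h.1.isLocalFamily (hfU hx)).pullback (hf.isLocalMap hx), fun x₀ hx₀ => ?_⟩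
  obtain ⟨V, hV, hx₀V, -, ψ, κ, κ', hψ, hκ, hκ', heq⟩ := h.2 (f x₀) (hfU hx₀)
  have hcont : ContinuousOn f U' := fun x hx => (hf.isLocalMap hx).continuousAt.continuousWithinAt
  have hV' : IsOpen (U' ∩ f ⁻¹' V) := hcont.isOpen_inter_preimage hU' hV
  exact ⟨U' ∩ f ⁻¹' V, hV', ⟨hx₀, hx₀V⟩, inter_subset_left, fun x => ψ (f x), fun x => κ (f x),
    fun x => κ' (f x),
    isFamily_of_isLocalFamily hV' fun x hx =>
      (hψ.isLocalFamily hx.2).pullback (hf.isLocalMap hx.1),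
    isStronglySmoothing_of_isLocalSmoothing hV' fun x hx =>
      (hκ.isLocalSmoothing hx.2).pullback (hf.isLocalMap hx.1),
    isStronglySmoothing_of_isLocalSmoothing hV' fun x hx =>
      (hκ'.isLocalSmoothing hx.2).pullback (hf.isLocalMap hx.1),
    fun x hx => heq (f x) hx.2⟩

/-- The parametrix is `θ η`, the product of the parametrices in reverse order. The error terms stay
smoothing by the ideal property. -/
theorem IsFredholmFamily.comp {φ : E → E₁ →ₗ[𝕜] E₂} {ψ : E → E₂ →ₗ[𝕜] E₃} (hU : IsOpen U)
    (hψ : IsFredholmFamily c U ψ) (hφ : IsFredholmFamily c U φ) :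
    IsFredholmFamily c U (fun x => (ψ x).comp (φ x)) := by
  refine ⟨isFamily_of_isLocalFamily hU fun x hx =>
    (hψ.1.isLocalFamily hx).comp (hφ.1.isLocalFamily hx), fun x₀ hx₀ => ?_⟩
  obtain ⟨V, hV, hx₀V, hVU, θ, κ, κ', hθ, hκ, hκ', heq⟩ := hφ.2 x₀ hx₀
  obtain ⟨W, hW, hx₀W, -, η, μ, μ', hη, hμ, hμ', heq'⟩ := hψ.2 x₀ hx₀
  refine ⟨V ∩ W, hV.inter hW, ⟨hx₀V, hx₀W⟩, inter_subset_left.trans hVU,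
    fun x => (θ x).comp (η x), fun x => κ x + (θ x).comp ((μ x).comp (φ x)),
    fun x => μ' x + (ψ x).comp ((κ' x).comp (η x)), ?_, ?_, ?_, fun x hx => ⟨?_, ?_⟩⟩
  · exact isFamily_of_isLocalFamily (hV.inter hW) fun x hx =>
      (hθ.isLocalFamily hx.1).comp (hη.isLocalFamily hx.2)
  · exact isStronglySmoothing_of_isLocalSmoothing (hV.inter hW) fun x hx =>
      (hκ.isLocalSmoothing hx.1).add ((hθ.isLocalFamily hx.1).comp_smoothing
        ((hμ.isLocalSmoothing hx.2).comp_family (hφ.1.isLocalFamily (hVU hx.1))))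
  · exact isStronglySmoothing_of_isLocalSmoothing (hV.inter hW) fun x hx =>
      (hμ'.isLocalSmoothing hx.2).add ((hψ.1.isLocalFamily (hVU hx.1)).comp_smoothing
        ((hκ'.isLocalSmoothing hx.1).comp_family (hη.isLocalFamily hx.2)))
  · calc _ = (θ x).comp (((η x).comp (ψ x)).comp (φ x)) := rfl
      _ = (θ x).comp (φ x) + (θ x).comp ((μ x).comp (φ x)) := by
        rw [(heq' x hx.2).1, LinearMap.add_comp, LinearMap.id_comp, LinearMap.comp_add]
      _ = _ := by rw [(heq x hx.1).1, add_assoc]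
  · calc _ = (ψ x).comp (((φ x).comp (θ x)).comp (η x)) := rfl
      _ = (ψ x).comp (η x) + (ψ x).comp ((κ' x).comp (η x)) := by
        rw [(heq x hx.1).2, LinearMap.add_comp, LinearMap.id_comp, LinearMap.comp_add]
      _ = _ := by rw [(heq' x hx.2).2, add_assoc]

/-- A strongly smoothing perturbation of a Fredholm family is Fredholm with the same
parametrices. -/
theorem IsFredholmFamily.add_smoothing {φ κ : E → E₁ →ₗ[𝕜] E₂} (hU : IsOpen U)
    (hφ : IsFredholmFamily c U φ) (hκ : IsStronglySmoothing c U κ) :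
    IsFredholmFamily c U (fun x => φ x + κ x) := by
  refine ⟨isFamily_of_isLocalFamily hU fun x hx =>
    (hφ.1.isLocalFamily hx).add (hκ.isLocalSmoothing hx).isLocalFamily, fun x₀ hx₀ => ?_⟩
  obtain ⟨V, hV, hx₀V, hVU, θ, μ, μ', hθ, hμ, hμ', heq⟩ := hφ.2 x₀ hx₀
  refine ⟨V, hV, hx₀V, hVU, θ, fun x => μ x + (θ x).comp (κ x), fun x => μ' x + (κ x).comp (θ x),
    hθ, ?_, ?_, fun x hx => ⟨?_, ?_⟩⟩
  · exact isStronglySmoothing_of_isLocalSmoothing hV fun x hx => (hμ.isLocalSmoothing hx).add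
      ((hθ.isLocalFamily hx).comp_smoothing (hκ.isLocalSmoothing (hVU hx)))
  · exact isStronglySmoothing_of_isLocalSmoothing hV fun x hx => (hμ'.isLocalSmoothing hx).add
      ((hκ.isLocalSmoothing (hVU hx)).comp_family (hθ.isLocalFamily hx))
  · rw [LinearMap.comp_add, (heq x hx).1, add_assoc]
  · rw [LinearMap.add_comp, (heq x hx).2, add_assoc]

/-- Both operators have the parametrix `θ x`, so both indices equal the negative of its index. -/
theorem IsFredholmFamily.fredholmIndex_add_smoothing {φ κ : E → E₁ →ₗ[𝕜] E₂}
    (hφ : IsFredholmFamily c U φ) (hκ : IsStronglySmoothing c U κ) {x : E} (hx : x ∈ U) :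
    fredholmIndex (φ x + κ x) = fredholmIndex (φ x) := by
  obtain ⟨V, hV, hxV, hVU, θ, μ, μ', hθ, hμ, hμ', heq⟩ := hφ.2 x hx
  have h₁ := (hμ.isLocalSmoothing hxV).isFredholmOfIndexZero
  have h₂ := (hμ'.isLocalSmoothing hxV).isFredholmOfIndexZero
  have hκx := hκ.isLocalSmoothing hx
  have h₃ := ((hμ.isLocalSmoothing hxV).add
    ((hθ.isLocalFamily hxV).comp_smoothing hκx)).isFredholmOfIndexZero
  have h₄ := ((hμ'.isLocalSmoothing hxV).add
    (hκx.comp_family (hθ.isLocalFamily hxV))).isFredholmOfIndexZero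
  rw [← (heq x hxV).1] at h₁
  rw [← (heq x hxV).2] at h₂
  rw [← add_assoc, ← (heq x hxV).1, ← LinearMap.comp_add] at h₃
  rw [← add_assoc, ← (heq x hxV).2, ← LinearMap.add_comp] at h₄
  have h₅ := (h₁.of_parametrix h₂).2.2
  have h₆ := (h₃.of_parametrix h₄).2.2
  exact h₆.trans h₅.symm

/-- Factor `φ + κ = φ (id + ψ κ)`. If `id + μ` inverts the second factor, the inverse is `(id + μ)
ψ`, so the correction is `μ ψ`. -/
theorem IsInverseFamily.exists_add_smoothing {φ κ : E → E₁ →ₗ[𝕜] E₂} {ψ : E → E₂ →ₗ[𝕜] E₁}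
    (hU : IsOpen U) {x₀ : E} (hx₀ : x₀ ∈ U) (h : IsInverseFamily c U φ ψ)
    (hκ : IsStronglySmoothing c U κ) (h₀ : κ x₀ = 0) :
    ∃ (V : Set E) (κ' : E → E₂ →ₗ[𝕜] E₁), IsOpen V ∧ x₀ ∈ V ∧ V ⊆ U ∧
      IsStronglySmoothing c V κ' ∧ κ' x₀ = 0 ∧
      IsInverseFamily c V (fun x => φ x + κ x) (fun x => ψ x + κ' x) := by
  obtain ⟨hφ, hψ, heq⟩ := h
  obtain ⟨V, μ, hV, hx₀V, hμ₀, hμ, hinv⟩ := ((hψ.isLocalFamily hx₀).comp_smoothing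
    (hκ.isLocalSmoothing hx₀)).exists_inverse (by rw [h₀, LinearMap.comp_zero])
  have hVU : IsOpen (V ∩ U) := hV.inter hU
  have hμψ : ∀ x ∈ V ∩ U, IsLocalSmoothing c (baseStructure 𝕜 E) (baseStructure 𝕜 E₂)
      (baseStructure 𝕜 E₁) x (fun x => (μ x).comp (ψ x)) := fun x hx =>
    (hμ x hx.1).comp_family (hψ.isLocalFamily hx.2)
  refine ⟨V ∩ U, fun x => (μ x).comp (ψ x), hVU, ⟨hx₀V, hx₀⟩, inter_subset_right,
    isStronglySmoothing_of_isLocalSmoothing hVU hμψ, by simp [hμ₀],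
    isFamily_of_isLocalFamily hVU fun x hx =>
      (hφ.isLocalFamily hx.2).add (hκ.isLocalSmoothing hx.2).isLocalFamily,
    isFamily_of_isLocalFamily hVU fun x hx =>
      (hψ.isLocalFamily hx.2).add (hμψ x hx).isLocalFamily, fun x hx => ?_⟩
  obtain ⟨h₁, h₂⟩ := heq x hx.2
  obtain ⟨h₃, h₄⟩ := hinv x hx.1
  have hl : φ x + κ x = (φ x).comp (LinearMap.id + (ψ x).comp (κ x)) := by
    rw [LinearMap.comp_add, LinearMap.comp_id, ← LinearMap.comp_assoc, h₂, LinearMap.id_comp]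
  have hr : ψ x + (μ x).comp (ψ x) = (LinearMap.id + μ x).comp (ψ x) := by
    rw [LinearMap.add_comp, LinearMap.id_comp]
  beta_reduce
  rw [hl, hr]
  constructor
  · calc _ = (LinearMap.id + μ x).comp (((ψ x).comp (φ x)).comp
          (LinearMap.id + (ψ x).comp (κ x))) := rfl
      _ = LinearMap.id := by rw [h₁, LinearMap.id_comp, h₄]
  · calc _ = (φ x).comp (((LinearMap.id + (ψ x).comp (κ x)).comp (LinearMap.id + μ x)).comp
          (ψ x)) := rfl
      _ = LinearMap.id := by rw [h₃, LinearMap.id_comp, h₂]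

end Fredholm

theorem proposition4p2
    {𝕜 : Type*} [RCLike 𝕜]
    {E : Type*} [AddCommGroup E] [Module 𝕜 E] [TopologicalSpace E] [ScFrechetSpace 𝕜 E]
    {E' : Type*} [AddCommGroup E'] [Module 𝕜 E'] [TopologicalSpace E'] [ScFrechetSpace 𝕜 E']
    {E₁ : Type*} [AddCommGroup E₁] [Module 𝕜 E₁] [TopologicalSpace E₁] [ScFrechetSpace 𝕜 E₁]
    {E₂ : Type*} [AddCommGroup E₂] [Module 𝕜 E₂] [TopologicalSpace E₂] [ScFrechetSpace 𝕜 E₂]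
    {E₃ : Type*} [AddCommGroup E₃] [Module 𝕜 E₃] [TopologicalSpace E₃] [ScFrechetSpace 𝕜 E₃]
    (c : ScContext) (U : Set E) (hU : IsOpen U) :
    -- local invertibility of perturbations of an invertible family
    (∀ (x₀ : E) (φ κ : E → E₁ →ₗ[𝕜] E₂) (φinv : E → E₂ →ₗ[𝕜] E₁), x₀ ∈ U →
      IsInverseFamily c U φ φinv → IsStronglySmoothing c U κ → κ x₀ = 0 →
      ∃ (V : Set E) (κ' : E → E₂ →ₗ[𝕜] E₁), IsOpen V ∧ x₀ ∈ V ∧ V ⊆ U ∧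
        IsStronglySmoothing c V κ' ∧ κ' x₀ = 0 ∧
        IsInverseFamily c V (fun x => φ x + κ x) (fun x => φinv x + κ' x)) ∧
    -- pullbacks of Fredholm families
    (∀ (U' : Set E') (f : E' → E) (φ : E → E₁ →ₗ[𝕜] E₂), IsOpen U' → MapsTo f U' U →
      IsScContinuousOn 𝕜 c U' f → IsFredholmFamily c U φ →
      IsFredholmFamily c U' (fun x' => φ (f x')) ∧
      (∀ x' ∈ U', IsFredholmOperator (φ (f x'))) ∧
      ∀ x' ∈ U', fredholmIndex ((fun y' => φ (f y')) x') = (fun x => fredholmIndex (φ x)) (f x')) ∧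
    -- compositions of Fredholm families
    (∀ (φ : E → E₁ →ₗ[𝕜] E₂) (ψ : E → E₂ →ₗ[𝕜] E₃), IsFredholmFamily c U φ →
      IsFredholmFamily c U ψ →
      IsFredholmFamily c U (fun x => (ψ x).comp (φ x)) ∧
      ∀ x ∈ U, IsFredholmOperator (φ x) ∧ IsFredholmOperator (ψ x) ∧
        IsFredholmOperator ((ψ x).comp (φ x)) ∧
        fredholmIndex ((ψ x).comp (φ x)) = fredholmIndex (ψ x) + fredholmIndex (φ x)) ∧
    -- strongly smoothing perturbations of Fredholm families
    (∀ φ κ : E → E₁ →ₗ[𝕜] E₂, IsFredholmFamily c U φ → IsStronglySmoothing c U κ →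
      IsFredholmFamily c U (fun x => φ x + κ x) ∧
      ∀ x ∈ U, IsFredholmOperator (φ x) ∧ IsFredholmOperator (φ x + κ x) ∧
        fredholmIndex (φ x + κ x) = fredholmIndex (φ x)) := by
  refine ⟨fun x₀ φ κ φinv hx₀ h hκ h₀ => h.exists_add_smoothing hU hx₀ hκ h₀,
    fun U' f φ hU' hfU hf h => ?_, fun φ ψ hφ hψ => ?_, fun φ κ hφ hκ => ?_⟩
  · exact ⟨h.pullback hU' hfU hf, fun x hx => h.isFredholmOperator (hfU hx), fun _ _ => rfl⟩
  · have hcomp := hψ.comp hU hφ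
    exact ⟨hcomp, fun x hx => ⟨hφ.isFredholmOperator hx, hψ.isFredholmOperator hx,
      hcomp.isFredholmOperator hx,
      (hψ.isFredholmOperator hx).fredholmIndex_comp (hφ.isFredholmOperator hx)⟩⟩
  · have hadd := hφ.add_smoothing hU hκ
    exact ⟨hadd, fun x hx => ⟨hφ.isFredholmOperator hx, hadd.isFredholmOperator hx,
      hφ.fredholmIndex_add_smoothing hκ hx⟩⟩
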